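/- Rings are associative and unital, and modules are unital. Let $A,B$ be rings and let ${}_BM_A$ be a $B$-$A$-bimodule. Let $\mathcal E_M$ be the class of $B$-bimodule homomorphisms $f:X\to Y$ for which ${}_B\mathrm{Hom}(M,f):{}_B\mathrm{Hom}(M,X)\to{}_B\mathrm{Hom}(M,Y)$ has a section in the category of $A$-$B$-bimodules. A $B$-bimodule $P$ is $\mathcal E_M$-projective if ${}_B\mathrm{Hom}_B(P,f)$ is surjective for every $f\in\mathcal E_M$. An $\mathcal E_M$-projective resolution of $B$ is an exact sequence of $B$-bimodules $\cdots\to P_1\to P_0\to B\to 0$ such that every $P_n$ is $\mathcal E_M$-projective and, for every map of the sequence, the epimorphism in its epi-mono factorization lies in $\mathcal E_M$. For a $B$-bimodule $N$, the $M$-Hochschild cohomology $\mathrm H_M^n(B,N)$, $n\ge 0$, is the $n$-th cohomology group of the complex ${}_B\mathrm{Hom}_B(P_\bullet,N)$, and $\mathrm{Hdim}_M(B)$ is the least $n\ge 0$ with $\mathrm H_M^{n+1}(B,N)=0$ for all $B$-bimodules $N$ ($\infty$ if there is none). For a ring homomorphism $A\to S$ and an $S$-bimodule $W$, let $\mathrm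 H^n(S|A,W)$, $n\ge0$, be the $A$-relative Hochschild cohomology, i.e. the $n$-th cohomology group of the complex with terms ${}_A\mathrm{Hom}_A(S^{\otimes_A n},W)$ (where $S^{\otimes_A 0}=A$) and differential $$b^n(f)=\mu^l_W\circ(S\otimes_A f)+\sum_{i=1}^n(-1)^i f\circ(S^{\otimes i-1}\otimes_A m_S\otimes_A S^{\otimes n-i})+(-1)^{n+1}\mu^r_W\circ(f\otimes_A S),$$ where $\mu^l_W,\mu^r_W$ are the left and right $S$-multiplications on $W$ and $m_S$ is the product of $S$ (for $n=0$ the isomorphisms $S\otimes_AA\cong S\cong A\otimes_AS$ are understood). Let $\mathrm{Hdim}(S|A)$ be the least $n\ge0$ with $\mathrm H^{n+1}(S|A,W)=0$ for all $S$-bimodules $W$ ($\infty$ if there is none). **Theorem.** Suppose that ${}_BM$ is a progenerator (a finitely generated projective generator of the category of left $B$-modules). Let $S={}_B\mathrm{End}(M)$ be the endomorphism ring of the left $B$-module $M$, with maps written on the right of their arguments, so that $M$ is a $B$-$S$-bimodule; let $A\to S$, $a\mapsto(m\mapsto ma)$, be the canonical ring homomorphism, and let ${}^*M={}_B\mathrm{Hom}(M,B)$,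 an $S$-$B$-bimodule. Then $B$ has an $\mathcal E_M$-projective resolution, and the following hold, whichever such resolution is used to compute $\mathrm H_M^\bullet(B,-)$. 1. For every $B$-bimodule $N$ and every $n\ge0$ there is an isomorphism of abelian groups $$\mathrm H_M^n(B,N)\cong\mathrm H^n(S|A,{}^*M\otimes_BN\otimes_BM).$$ 2. For each fixed $n\ge0$: $\mathrm H_M^n(B,N)=0$ for every $B$-bimodule $N$ if and only if $\mathrm H^n(S|A,W)=0$ for every $S$-bimodule $W$. 3. $\mathrm{Hdim}_M(B)=\mathrm{Hdim}(S|A)$ (in particular one is finite if and only if the other is). -/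

import Mathlib

universe u

open MulOpposite TensorProduct

noncomputable section

/-- An `R`-`S`-bimodule: an abelian group with a left `R`-action and a commuting right `S`-action
(the right action is written as a left action of the opposite ring). -/
structure RBimod (R S : Type u) [Ring R] [Ring S] where
  carrier : Type u
  [addCommGroup : AddCommGroup carrier]
  [left : Module R carrier]
  [right : Module Sᵐᵒᵖ carrier]
  [comm : SMulCommClass R Sᵐᵒᵖ carrier]

namespace RBimod

instance {R S : Type u} [Ring R] [Ring S] : CoeSort (RBimod R S) (Type u) := ⟨RBimod.carrier⟩

attribute [instance] RBimod.addCommGroup RBimod.left RBimod.right RBimod.comm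

section Basic

variable {R S T : Type u} [Ring R] [Ring S] [Ring T]

/-- The ring `R` as a bimodule over itself. -/
def self (R : Type u) [Ring R] : RBimod R R where
  carrier := R

/-- Restriction of scalars along ring homomorphisms on both sides. -/
def restrict {R' S' : Type u} [Ring R'] [Ring S'] (i : R' →+* R) (j : S' →+* S)
    (X : RBimod R S) : RBimod R' S' :=
  letI : Module R' X := Module.compHom X i
  letI : Module S'ᵐᵒᵖ X := Module.compHom X j.op
  { carrier := X
    comm := ⟨fun r s x => smul_comm (i r) (op (j s.unop)) x⟩ }

/-- The group of `R`-`S`-bimodule homomorphisms. -/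
def homs (X Y : RBimod R S) : AddSubgroup (X →+ Y) where
  carrier := {f | (∀ (r : R) (x : X), f (r • x) = r • f x) ∧
    ∀ (s : S) (x : X), f (op s • x) = op s • f x}
  add_mem' := fun hf hg =>
    ⟨fun r x => by simp [hf.1, hg.1], fun s x => by simp [hf.2, hg.2]⟩
  zero_mem' := ⟨fun r x => by simp, fun s x => by simp⟩
  neg_mem' := fun hf => ⟨fun r x => by simp [hf.1], fun s x => by simp [hf.2]⟩

/-- RBimodule homomorphisms, with their abelian group structure. -/
abbrev Hom (X Y : RBimod R S) : Type u := homs X Y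

instance (X Y : RBimod R S) : CoeFun (Hom X Y) (fun _ => X → Y) := ⟨fun f => f.1⟩

/-- The composite `g ∘ f`. -/
def Hom.comp {X Y Z : RBimod R S} (g : Hom Y Z) (f : Hom X Y) : Hom X Z :=
  ⟨g.1.comp f.1, fun r x => by simp [f.2.1, g.2.1], fun s x => by simp [f.2.2, g.2.2]⟩

/-- Composition with a fixed `f : X → Y`, as a group homomorphism `Hom(Y, Z) → Hom(X, Z)`. -/
def Hom.precomp {X Y : RBimod R S} (f : Hom X Y) (Z : RBimod R S) : Hom Y Z →+ Hom X Z where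
  toFun g := g.comp f
  map_zero' := rfl
  map_add' _ _ := rfl

/-- The identity homomorphism. -/
def Hom.id (X : RBimod R S) : Hom X X := ⟨AddMonoidHom.id X, fun _ _ => rfl, fun _ _ => rfl⟩

/-! ### Tensor products over noncommutative rings -/

/-- The relations `x s ⊗ y = x ⊗ s y` imposed on `X ⊗_ℤ Y`. -/
def tensorRel (X : RBimod R S) (Y : RBimod S T) : AddSubgroup (X ⊗[ℤ] Y) :=
  AddSubgroup.closure
    {z | ∃ (x : X) (s : S) (y : Y), z = (op s • x) ⊗ₜ[ℤ] y - x ⊗ₜ[ℤ] (s • y)}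

/-- The underlying abelian group of `X ⊗_S Y`. -/
def TensorCarrier (X : RBimod R S) (Y : RBimod S T) : Type u := (X ⊗[ℤ] Y) ⧸ tensorRel X Y

instance (X : RBimod R S) (Y : RBimod S T) : AddCommGroup (TensorCarrier X Y) :=
  inferInstanceAs (AddCommGroup ((X ⊗[ℤ] Y) ⧸ tensorRel X Y))

/-- The universal balanced biadditive map `X × Y → X ⊗_S Y`. -/
def tmk (X : RBimod R S) (Y : RBimod S T) : X →+ Y →+ TensorCarrier X Y :=
  AddMonoidHom.mk'
    (fun x => AddMonoidHom.mk' (fun y => QuotientAddGroup.mk' (tensorRel X Y) (x ⊗ₜ[ℤ] y))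
      fun y y' => congrArg (QuotientAddGroup.mk' (tensorRel X Y)) (TensorProduct.tmul_add x y y'))
    fun x x' => AddMonoidHom.ext fun y =>
      congrArg (QuotientAddGroup.mk' (tensorRel X Y)) (TensorProduct.add_tmul x x' y)

theorem tmk_smul (X : RBimod R S) (Y : RBimod S T) (x : X) (s : S) (y : Y) :
    tmk X Y (op s • x) y = tmk X Y x (s • y) := by
  refine sub_eq_zero.1 ?_
  refine Eq.trans (map_sub (QuotientAddGroup.mk' (tensorRel X Y)) _ _).symm ?_
  exact (QuotientAddGroup.eq_zero_iff _).2 (AddSubgroup.subset_closure ⟨x, s, y, rfl⟩)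

/-- The universal property of `X ⊗_S Y`. -/
def lift {X : RBimod R S} {Y : RBimod S T} {Z : Type u} [AddCommGroup Z] (f : X →+ Y →+ Z)
    (hf : ∀ x (s : S) y, f (op s • x) y = f x (s • y)) : TensorCarrier X Y →+ Z :=
  QuotientAddGroup.lift (tensorRel X Y)
    (TensorProduct.liftAddHom f fun r x y => by simp)
    (by
      rw [tensorRel, AddSubgroup.closure_le]
      rintro _ ⟨x, s, y, rfl⟩
      simp [hf])

theorem lift_tmk {X : RBimod R S} {Y : RBimod S T} {Z : Type u} [AddCommGroup Z] (f : X →+ Y →+ Z)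
    (hf : ∀ x (s : S) y, f (op s • x) y = f x (s • y)) (x : X) (y : Y) :
    lift f hf (tmk X Y x y) = f x y := rfl

theorem tensor_ext {X : RBimod R S} {Y : RBimod S T} {Z : Type u} [AddCommGroup Z]
    {f g : TensorCarrier X Y →+ Z} (h : ∀ x y, f (tmk X Y x y) = g (tmk X Y x y)) : f = g := by
  refine AddMonoidHom.ext fun z => ?_
  obtain ⟨z, rfl⟩ := QuotientAddGroup.mk'_surjective (tensorRel X Y) z
  induction z using TensorProduct.induction_on with
  | zero => exact (map_zero f).trans (map_zero g).symm
  | tmul x y => exact h x y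
  | add a b ha hb =>
    exact (map_add f (QuotientAddGroup.mk' _ a) (QuotientAddGroup.mk' _ b)).trans
      ((congrArg₂ _ ha hb).trans
        (map_add g (QuotientAddGroup.mk' _ a) (QuotientAddGroup.mk' _ b)).symm)

/-- The left action on `X ⊗_S Y`: `r (x ⊗ y) = (r x) ⊗ y`. -/
def leftAct (X : RBimod R S) (Y : RBimod S T) : R →+* AddMonoid.End (TensorCarrier X Y) where
  toFun r := lift ((tmk X Y).comp (DistribSMul.toAddMonoidHom X r)) fun x s y => by
    simp only [AddMonoidHom.comp_apply, DistribSMul.toAddMonoidHom_apply]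
    rw [smul_comm, tmk_smul]
  map_one' := tensor_ext fun x y => congrArg (fun x => tmk X Y x y) (one_smul R x)
  map_mul' r r' := tensor_ext fun x y => congrArg (fun x => tmk X Y x y) (mul_smul r r' x)
  map_zero' := tensor_ext fun x y => (congrArg (fun x => tmk X Y x y) (zero_smul R x)).trans
    (DFunLike.congr_fun (map_zero (tmk X Y)) y)
  map_add' r r' := tensor_ext fun x y => (congrArg (fun x => tmk X Y x y) (add_smul r r' x)).trans
    (DFunLike.congr_fun (map_add (tmk X Y) (r • x) (r' • x)) y)

/-- The right action on `X ⊗_S Y`: `(x ⊗ y) t = x ⊗ (y t)`. -/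
def rightAct (X : RBimod R S) (Y : RBimod S T) :
    Tᵐᵒᵖ →+* AddMonoid.End (TensorCarrier X Y) where
  toFun t := lift ((tmk X Y).compl₂ (DistribSMul.toAddMonoidHom Y t)) fun x s y => by
    simp only [AddMonoidHom.compl₂_apply, DistribSMul.toAddMonoidHom_apply]
    rw [← smul_comm, tmk_smul]
  map_one' := tensor_ext fun x y => congrArg (tmk X Y x) (one_smul Tᵐᵒᵖ y)
  map_mul' t t' := tensor_ext fun x y => congrArg (tmk X Y x) (mul_smul t t' y)
  map_zero' := tensor_ext fun x y => (congrArg (tmk X Y x) (zero_smul Tᵐᵒᵖ y)).trans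
    (map_zero (tmk X Y x))
  map_add' t t' := tensor_ext fun x y => (congrArg (tmk X Y x) (add_smul t t' y)).trans
    (map_add (tmk X Y x) (t • y) (t' • y))

/-- The tensor product `X ⊗_S Y` of an `R`-`S`-bimodule and an `S`-`T`-bimodule, as an
`R`-`T`-bimodule. -/
def tensor (X : RBimod R S) (Y : RBimod S T) : RBimod R T :=
  letI : Module R (TensorCarrier X Y) := Module.compHom _ (leftAct X Y)
  letI : Module Tᵐᵒᵖ (TensorCarrier X Y) := Module.compHom _ (rightAct X Y)
  { carrier := TensorCarrier X Y
    comm := ⟨fun r t z => by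
      have h : (leftAct X Y r).comp (rightAct X Y t) = (rightAct X Y t).comp (leftAct X Y r) :=
        tensor_ext fun x y => rfl
      exact DFunLike.congr_fun h z⟩ }

/-- The pure tensor `x ⊗ y`. -/
def tmul {X : RBimod R S} {Y : RBimod S T} (x : X) (y : Y) : tensor X Y := tmk X Y x y

theorem tmul_add {X : RBimod R S} {Y : RBimod S T} (x : X) (y y' : Y) :
    tmul x (y + y') = tmul x y + tmul x y' := map_add (tmk X Y x) y y'

theorem add_tmul {X : RBimod R S} {Y : RBimod S T} (x x' : X) (y : Y) :
    tmul (x + x') y = tmul x y + tmul x' y :=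
  DFunLike.congr_fun (map_add (tmk X Y) x x') y

theorem smul_tmul {X : RBimod R S} {Y : RBimod S T} (x : X) (s : S) (y : Y) :
    tmul (op s • x) y = tmul x (s • y) := tmk_smul X Y x s y

theorem left_tmul {X : RBimod R S} {Y : RBimod S T} (r : R) (x : X) (y : Y) :
    r • tmul x y = tmul (r • x) y := rfl

theorem right_tmul {X : RBimod R S} {Y : RBimod S T} (t : Tᵐᵒᵖ) (x : X) (y : Y) :
    t • tmul x y = tmul x (t • y) := rfl

/-- Additive maps out of a tensor product agree if they agree on pure tensors. -/
theorem hom_ext {X : RBimod R S} {Y : RBimod S T} {Z : Type u} [AddCommGroup Z]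
    {f g : tensor X Y →+ Z} (h : ∀ x y, f (tmul x y) = g (tmul x y)) : f = g :=
  tensor_ext (X := X) (Y := Y) h

/-- The bimodule homomorphism out of `X ⊗_S Y` given by a balanced biadditive map that is left
linear in the first and right linear in the second variable. -/
def tensorLift {X : RBimod R S} {Y : RBimod S T} {Z : RBimod R T} (f : X →+ Y →+ Z)
    (hf : ∀ x (s : S) y, f (op s • x) y = f x (s • y))
    (hl : ∀ (r : R) x y, f (r • x) y = r • f x y)
    (hr : ∀ (t : T) x y, f x (op t • y) = op t • f x y) : Hom (tensor X Y) Z :=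
  ⟨lift f hf, fun r z => by
      have h : (lift f hf).comp (DistribSMul.toAddMonoidHom (tensor X Y) r) =
          (DistribSMul.toAddMonoidHom Z r).comp (lift f hf) := hom_ext fun x y => hl r x y
      exact DFunLike.congr_fun h z, fun t z => by
      have h : (lift f hf).comp (DistribSMul.toAddMonoidHom (tensor X Y) (op t)) =
          (DistribSMul.toAddMonoidHom Z (op t)).comp (lift f hf) := hom_ext fun x y => hr t x y
      exact DFunLike.congr_fun h z⟩

/-- The homomorphism `f ⊗ g`, with `(f ⊗ g)(x ⊗ y) = f x ⊗ g y`. -/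
def tensorMap {X X' : RBimod R S} {Y Y' : RBimod S T} (f : Hom X X') (g : Hom Y Y') :
    Hom (tensor X Y) (tensor X' Y') :=
  tensorLift (((tmk X' Y').comp f.1).compl₂ g.1)
    (fun x s y => (congrArg (fun z => tmul z (g y)) (f.2.2 s x)).trans
      ((smul_tmul _ _ _).trans (congrArg (tmul (f x)) (g.2.1 s y).symm)))
    (fun r x y => congrArg (fun z => tmul z (g y)) (f.2.1 r x))
    (fun t x y => congrArg (tmul (f x)) (g.2.2 t y))

/-- For fixed `x`, the map `y ⊗ z ↦ (x ⊗ y) ⊗ z`. -/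
def assocAux {U : Type u} [Ring U] (X : RBimod R S) (Y : RBimod S T) (Z : RBimod T U) (x : X) :
    tensor Y Z →+ tensor (tensor X Y) Z :=
  lift (AddMonoidHom.mk' (fun y => tmk (tensor X Y) Z (tmul x y)) fun y y' =>
    (congrArg (tmk (tensor X Y) Z) (tmul_add x y y')).trans (map_add _ _ _))
    fun y t z => smul_tmul (tmul x y) t z

/-- The associativity isomorphism `x ⊗ (y ⊗ z) ↦ (x ⊗ y) ⊗ z`, as a homomorphism. -/
def tensorAssoc {U : Type u} [Ring U] (X : RBimod R S) (Y : RBimod S T) (Z : RBimod T U) :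
    Hom (tensor X (tensor Y Z)) (tensor (tensor X Y) Z) :=
  tensorLift
    (AddMonoidHom.mk' (assocAux X Y Z) fun x x' => hom_ext fun y z =>
      (congrArg (fun w => tmul w z) (add_tmul x x' y)).trans (add_tmul _ _ z))
    (fun x s w => DFunLike.congr_fun (f := assocAux X Y Z (op s • x))
      (g := (assocAux X Y Z x).comp (DistribSMul.toAddMonoidHom (tensor Y Z) s))
      (hom_ext fun y z => congrArg (fun w => tmul w z) (smul_tmul x s y)) w)
    (fun r x w => DFunLike.congr_fun (f := assocAux X Y Z (r • x))
      (g := (DistribSMul.toAddMonoidHom (tensor (tensor X Y) Z) r).comp (assocAux X Y Z x))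
      (hom_ext fun _ _ => rfl) w)
    (fun t x w => DFunLike.congr_fun
      (f := (assocAux X Y Z x).comp (DistribSMul.toAddMonoidHom (tensor Y Z) (op t)))
      (g := (DistribSMul.toAddMonoidHom (tensor (tensor X Y) Z) (op t)).comp (assocAux X Y Z x))
      (hom_ext fun _ _ => rfl) w)

end Basic

/-! ### Hom-bimodules and the endomorphism ring -/

section HomBimodules

variable {A B T : Type u} [Ring A] [Ring B] [Ring T]

/-- Right multiplication by `a` as a left `B`-linear endomorphism of a `B`-`A`-bimodule. -/
def rightMulLin (M : RBimod B A) (a : A) : M →ₗ[B] M where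
  toFun m := op a • m
  map_add' := smul_add _
  map_smul' b m := (smul_comm b (op a) m).symm

/-- The `A`-`T`-bimodule of left `B`-linear maps `M → X`, with
`(a f t)(m) = f (m a) t`. -/
def homLeft (M : RBimod B A) (X : RBimod B T) : RBimod A T :=
  letI : Module A (M →ₗ[B] X) :=
    { smul := fun a f => f.comp (rightMulLin M a)
      one_smul := fun f => LinearMap.ext fun m => congrArg f (one_smul Aᵐᵒᵖ m)
      mul_smul := fun a a' f => LinearMap.ext fun m => congrArg f (mul_smul (op a') (op a) m)
      smul_zero := fun _ => LinearMap.ext fun _ => rfl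
      smul_add := fun _ _ _ => LinearMap.ext fun _ => rfl
      add_smul := fun a a' f => LinearMap.ext fun m =>
        (congrArg f (add_smul (op a) (op a') m)).trans (map_add f _ _)
      zero_smul := fun f => LinearMap.ext fun m =>
        (congrArg f (zero_smul Aᵐᵒᵖ m)).trans (map_zero f) }
  { carrier := M →ₗ[B] X
    comm := ⟨fun _ _ _ => LinearMap.ext fun _ => rfl⟩ }

/-- A homomorphism of `B`-`T`-bimodules as a left `B`-linear map. -/
def Hom.toLin {X Y : RBimod B T} (f : Hom X Y) : X →ₗ[B] Y where
  toFun := f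
  map_add' := map_add f.1
  map_smul' := f.2.1

/-- The homomorphism `_B Hom(M, f) : _B Hom(M, X) → _B Hom(M, Y)`, `g ↦ f ∘ g`, of
`A`-`T`-bimodules. -/
def homLeftMap (M : RBimod B A) {X Y : RBimod B T} (f : Hom X Y) :
    Hom (homLeft M X) (homLeft M Y) :=
  ⟨AddMonoidHom.mk' (fun g : M →ₗ[B] X => (f.toLin.comp g : M →ₗ[B] Y))
      fun g h => LinearMap.comp_add g h f.toLin,
    fun _ _ => rfl,
    fun t (g : M →ₗ[B] X) => LinearMap.ext fun m => f.2.2 t (g m)⟩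

/-- The dual `A`-`B`-bimodule `*M = _B Hom(M, B)`. -/
def leftDual (M : RBimod B A) : RBimod A B := homLeft M (self B)

/-- The endomorphism ring `S` of the left `B`-module `M`, with maps written on the right of their
arguments: the product `s * s'` is "first `s`, then `s'`". -/
abbrev EndRing (M : RBimod B A) : Type u := (Module.End B M)ᵐᵒᵖ

/-- The canonical ring homomorphism `A → S`, `a ↦ (m ↦ m a)`. -/
def toEndRing (M : RBimod B A) : A →+* EndRing M where
  toFun a := op (rightMulLin M a)
  map_one' := congrArg op (LinearMap.ext fun m => one_smul Aᵐᵒᵖ m)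
  map_mul' a a' := congrArg op (LinearMap.ext fun m => mul_smul (op a') (op a) m)
  map_zero' := congrArg op (LinearMap.ext fun m => zero_smul Aᵐᵒᵖ m)
  map_add' a a' := congrArg op (LinearMap.ext fun m => add_smul (op a) (op a') m)

/-- `M` as a `B`-`S`-bimodule, with `m s = s(m)`. -/
def overEnd (M : RBimod B A) : RBimod B (EndRing M) :=
  letI : Module (EndRing M)ᵐᵒᵖ M := Module.compHom M (RingEquiv.opOp (Module.End B M)).symm.toRingHom
  { carrier := M
    comm := ⟨fun b s m => (map_smul s.unop.unop b m).symm⟩ }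

/-- The `S`-bimodule `*M ⊗_B N ⊗_B M`. -/
def coeff (M : RBimod B A) (N : RBimod B B) : RBimod (EndRing M) (EndRing M) :=
  tensor (tensor (leftDual (overEnd M)) N) (overEnd M)

/-- `M` is a progenerator as a left `B`-module: a finitely generated projective generator. -/
structure IsLeftProgenerator (M : RBimod B A) : Prop where
  finite : Module.Finite B M
  projective : Module.Projective B M
  generator : CategoryTheory.IsSeparator (ModuleCat.of B M)

end HomBimodules

/-! ### Cohomology of a cochain complex -/

section Cohomology

variable (C : ℕ → Type u) [∀ n, AddCommGroup (C n)] (d : ∀ n, C n →+ C (n + 1))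

/-- The image of the differential in degree `n`; zero in degree `0`. -/
def coboundaries : ∀ n, AddSubgroup (C n)
  | 0 => ⊥
  | n + 1 => (d n).range

/-- The `n`-th cohomology group of the cochain complex `C 0 → C 1 → C 2 → ⋯`. -/
def cohomology (n : ℕ) : Type u :=
  (d n).ker ⧸ (coboundaries C d n).addSubgroupOf (d n).ker

instance (n : ℕ) : AddCommGroup (cohomology C d n) :=
  inferInstanceAs (AddCommGroup ((d n).ker ⧸ (coboundaries C d n).addSubgroupOf (d n).ker))

end Cohomology

/-- `min {n | H^{n+1} vanishes}`, where `V n` says that `H^n` vanishes; it is `⊤` if there is no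
such `n`. -/
def dimOf (V : ℕ → Prop) : ℕ∞ := ⨅ (n : ℕ) (_ : V (n + 1)), (n : ℕ∞)

/-! ### Cohomology relative to a bimodule -/

section Relative

variable {A B : Type u} [Ring A] [Ring B] (M : RBimod B A)

/-- `f` belongs to the class `E_M`: the map `_B Hom(M, f)` is a split epimorphism of
`A`-`B`-bimodules. -/
def RelSplit {X Y : RBimod B B} (f : Hom X Y) : Prop :=
  ∃ σ : Hom (homLeft M Y) (homLeft M X), (homLeftMap M f).comp σ = Hom.id (homLeft M Y)

/-- `P` is `E_M`-projective. -/
def IsRelProjective (P : RBimod B B) : Prop :=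
  ∀ (X Y : RBimod B B) (f : Hom X Y), RelSplit M f →
    ∀ g : Hom P Y, ∃ h : Hom P X, f.comp h = g

/-- `f` is `E_M`-admissible: in its factorization into an epimorphism followed by a monomorphism
the epimorphism belongs to `E_M`. -/
def IsAdmissible {X Y : RBimod B B} (f : Hom X Y) : Prop :=
  ∃ (I : RBimod B B) (ξ : Hom X I) (μ : Hom I Y), Function.Surjective ξ ∧ Function.Injective μ ∧
    μ.comp ξ = f ∧ RelSplit M ξ

/-- An `E_M`-projective resolution `⋯ → P₂ → P₁ → P₀ → X → 0` of the `B`-bimodule `X`. -/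
structure RelResolution (X : RBimod B B) where
  P : ℕ → RBimod B B
  d : ∀ n, Hom (P (n + 1)) (P n)
  ε : Hom (P 0) X
  projective : ∀ n, IsRelProjective M (P n)
  surjective : Function.Surjective ε
  exact_zero : Function.Exact (d 0) ε
  exact_succ : ∀ n, Function.Exact (d (n + 1)) (d n)
  admissible_ε : IsAdmissible M ε
  admissible_d : ∀ n, IsAdmissible M (d n)

variable {M}

/-- The `n`-th right `E_M`-derived functor of `_B Hom_B(-, N)` at `X`, computed with the given
`E_M`-projective resolution of `X`. For `X = B` it is the `n`-th `M`-Hochschild cohomology group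
`H_M^n(B, N)`. -/
abbrev RelResolution.Ext {X : RBimod B B} (P : RelResolution M X) (N : RBimod B B) (n : ℕ) :
    Type u :=
  cohomology (fun k => Hom (P.P k) N) (fun k => (P.d k).precomp N) n

/-- `H_M^n(B, N) = 0` for all `B`-bimodules `N`. -/
def RelResolution.Vanishes (P : RelResolution M (self B)) (n : ℕ) : Prop :=
  ∀ N : RBimod B B, Subsingleton (P.Ext N n)

/-- The `M`-Hochschild dimension of `B`. -/
def RelResolution.hdim (P : RelResolution M (self B)) : ℕ∞ := dimOf P.Vanishes

end Relative

/-! ### Relative Hochschild cohomology of a ring extension `i : A → S` -/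

section Hochschild

variable {A S : Type u} [Ring A] [Ring S] (i : A →+* S)

/-- An `S`-bimodule as an `A`-bimodule. -/
abbrev res (W : RBimod S S) : RBimod A A := W.restrict i i

/-- The tensor powers `S^{⊗_A n}`, with `S^{⊗_A 0} = A`. -/
def tpow : ℕ → RBimod A A
  | 0 => self A
  | n + 1 => tensor (res i (self S)) (tpow n)

/-- The left multiplication `S ⊗_A W → W`, `s ⊗ w ↦ s w`. -/
def leftMul (W : RBimod S S) : Hom (tensor (res i (self S)) (res i W)) (res i W) :=
  tensorLift (X := res i (self S)) (Y := res i W) (Z := res i W)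
    (AddMonoidHom.mk' (fun s : S => DistribSMul.toAddMonoidHom W s)
      fun s s' : S => AddMonoidHom.ext fun w : W => add_smul s s' w)
    (fun (s : S) (a : A) (w : W) => mul_smul s (i a) w)
    (fun (a : A) (s : S) (w : W) => mul_smul (i a) s w)
    (fun (a : A) (s : S) (w : W) => smul_comm s (op (i a)) w)

/-- The right multiplication `W ⊗_A S → W`, `w ⊗ s ↦ w s`. -/
def rightMul (W : RBimod S S) : Hom (tensor (res i W) (res i (self S))) (res i W) :=
  tensorLift (X := res i W) (Y := res i (self S)) (Z := res i W)
    (AddMonoidHom.mk' (fun w : W => AddMonoidHom.mk' (fun s : S => op s • w)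
        fun s s' : S => add_smul (op s) (op s') w)
      fun w w' : W => AddMonoidHom.ext fun s : S => smul_add (op s) w w')
    (fun (w : W) (a : A) (s : S) => (mul_smul (op s) (op (i a)) w).symm)
    (fun (a : A) (w : W) (s : S) => (smul_comm (i a) (op s) w).symm)
    (fun (a : A) (w : W) (s : S) => mul_smul (op (i a)) (op s) w)

/-- `S ⊗_A S ⊗_A X → S ⊗_A X`, `s ⊗ s' ⊗ x ↦ s s' ⊗ x`. -/
def mulHead (X : RBimod A A) :
    Hom (tensor (res i (self S)) (tensor (res i (self S)) X)) (tensor (res i (self S)) X) :=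
  (tensorMap (leftMul i (self S)) (Hom.id X)).comp (tensorAssoc _ _ _)

/-- `mulAt n j : S^{⊗ n+1} → S^{⊗ n}` multiplies the (adjacent) factors in positions `j`, `j+1`
(counted from `0`), that is, it is `S^{⊗ j} ⊗ m_S ⊗ S^{⊗ n-1-j}`. -/
def mulAt : ∀ n, Fin n → Hom (tpow i (n + 1)) (tpow i n)
  | 0 => fun j => j.elim0
  | n + 1 => Fin.cases (mulHead i (tpow i n)) fun j => tensorMap (Hom.id _) (mulAt n j)

/-- `S ⊗_A A → A ⊗_A S`, `s ⊗ a ↦ 1 ⊗ s a`. -/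
def unitSwap : Hom (tensor (res i (self S)) (self A)) (tensor (self A) (res i (self S))) :=
  Hom.comp
    (⟨tmk (self A) (res i (self S)) (1 : A),
      fun a s => (smul_tmul (X := self A) (Y := res i (self S)) (1 : A) a s).symm.trans
        (congrArg (fun b : A => tmul (X := self A) (Y := res i (self S)) b s)
          ((one_mul a).trans (mul_one a).symm)),
      fun _ _ => rfl⟩ : Hom (res i (self S)) (tensor (self A) (res i (self S))))
    (tensorLift (X := res i (self S)) (Y := self A) (Z := res i (self S))
      (AddMonoidHom.mk' (fun s : S => AddMonoidHom.mk' (fun a : A => s * i a)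
          fun a a' : A => (congrArg (s * ·) (map_add i a a')).trans (mul_add s (i a) (i a')))
        fun s s' : S => AddMonoidHom.ext fun a : A => add_mul s s' (i a))
      (fun (s : S) (a a' : A) => (mul_assoc s (i a) (i a')).trans
        (congrArg (s * ·) (map_mul i a a').symm))
      (fun (a : A) (s : S) (a' : A) => mul_assoc (i a) s (i a'))
      (fun (a : A) (s : S) (a' : A) => (congrArg (s * ·) (map_mul i a' a)).trans
        (mul_assoc s (i a') (i a)).symm))

/-- The identification `S^{⊗ n+1} → S^{⊗ n} ⊗_A S` that splits off the last factor. -/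
def splitLast : ∀ n, Hom (tpow i (n + 1)) (tensor (tpow i n) (res i (self S)))
  | 0 => unitSwap i
  | n + 1 => (tensorAssoc _ _ _).comp (tensorMap (Hom.id _) (splitLast n))

/-- The cochains `_A Hom_A(S^{⊗_A n}, W)`. -/
abbrev Cochain (W : RBimod S S) (n : ℕ) : Type u := Hom (tpow i n) (res i W)

/-- `f ↦ μ_W^l ∘ (S ⊗_A f)`. -/
def leftFace (W : RBimod S S) (n : ℕ) : Cochain i W n →+ Cochain i W (n + 1) :=
  AddMonoidHom.mk' (fun f => (leftMul i W).comp (tensorMap (Hom.id (res i (self S))) f))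
    fun f g => Subtype.ext (hom_ext fun (s : S) x => smul_add (A := W) s (f x) (g x))

/-- `f ↦ μ_W^r ∘ (f ⊗_A S)`. -/
def rightFace (W : RBimod S S) (n : ℕ) : Cochain i W n →+ Cochain i W (n + 1) :=
  AddMonoidHom.mk'
    (fun f => ((rightMul i W).comp (tensorMap f (Hom.id (res i (self S))))).comp (splitLast i n))
    fun f g => by
      have h : (rightMul i W).comp (tensorMap (f + g) (Hom.id (res i (self S)))) =
          (rightMul i W).comp (tensorMap f (Hom.id (res i (self S)))) +
          (rightMul i W).comp (tensorMap g (Hom.id (res i (self S)))) :=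
        Subtype.ext (hom_ext fun x (s : S) => smul_add (A := W) (op s) (f x) (g x))
      exact congrArg (fun k => Hom.comp k (splitLast i n)) h

/-- The Hochschild differential `b^n`. -/
def hochschildD (W : RBimod S S) (n : ℕ) : Cochain i W n →+ Cochain i W (n + 1) :=
  leftFace i W n + ∑ j : Fin n, (-1 : ℤ) ^ (j.val + 1) • (mulAt i n j).precomp (res i W) +
    (-1 : ℤ) ^ (n + 1) • rightFace i W n

/-- The `A`-relative Hochschild cohomology `H^n(S | A, W)`. -/
abbrev relHochschild (W : RBimod S S) (n : ℕ) : Type u :=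
  cohomology (Cochain i W) (hochschildD i W) n

/-- `H^n(S | A, W) = 0` for all `S`-bimodules `W`. -/
def HochschildVanishes (n : ℕ) : Prop :=
  ∀ W : RBimod S S, Subsingleton (relHochschild i W n)

/-- The Hochschild dimension of `S` over `A`. -/
def relHdim : ℕ∞ := dimOf (HochschildVanishes i)

end Hochschild

end RBimod

end

/-!
For a progenerator `M` over `B`, with endomorphism ring `S`, the cohomology of `B` relative to `M`
is computed by one explicit resolution, whose complex of homomorphisms into a `B`-bimodule `N` is
isomorphic to the complex of relative Hochschild cochains of `S` over `A`.

*The resolution.* The functors `M ⊗_A -` and `_B Hom(M, -)` are adjoint, and `M ⊗_A Y` is projective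
relative to `M` for every `A`-`B`-bimodule `Y`. Iterating the comonad `M ⊗_A _B Hom(M, -)` gives the
terms `M ⊗_A Y_n` with `Y_0 = *M` and `Y_{n+1} = _B Hom(M, M ⊗_A Y_n)` (`barGen`). The differential
`bard` is defined recursively, so that the unit of the adjunction is a contracting homotopy after
applying `_B Hom(M, -)`. The trace ideal of the generator `M` is all of `B`, so every element of a
`B`-module is a sum of values of linear maps from `M`, and the homotopy yields exactness and
admissibility (`IsLeftProgenerator.exact_and_admissible`). By the comparison theorem
(`RelResolution.nonempty_extEquiv`) any other relative projective resolution computes the same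
groups.

*Comparison with Hochschild cochains.* Since `M` is finitely generated projective,
`S ⊗_A Y ≅ _B Hom(M, M ⊗_A Y)` for every `Y`, so that `S^{⊗ n} ⊗_A *M ≅ Y_n` by induction on `n`
(`IsLeftProgenerator.barθ_bijective`). A homomorphism `f : M ⊗_A Y_n → N` is then the same as an
`A`-bimodule homomorphism from `S^{⊗ n}` to the `S`-bimodule of bilinear maps `M × *M → N`
(`barCochainHom_bijective`). The recursion for the differential of the resolution is the one
satisfied by the Hochschild differential (`barD_barθ`, `hochschildD_barCochain`).

*Coefficients.* A dual basis of `M` identifies the bimodule of bilinear maps `M × *M → N` with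
`*M ⊗_B N ⊗_B M` (`dualTensorBiHom_bijective`). It also shows that every `S`-bimodule `W` is of this
form, with `N` the bimodule of bilinear maps `*M × M → W` (`toBiHomBiHom_bijective`). Hence the
relative cohomology of `B` vanishes in some degree for all coefficients if and only if the
Hochschild cohomology of `S` over `A` does, and the two dimensions agree.
-/

namespace RBimod

/-! ### Homomorphisms and cohomology of cochain complexes -/

section HomLemmas

variable {R S : Type u} [Ring R] [Ring S]

theorem Hom.ext {X Y : RBimod R S} {f g : Hom X Y} (h : ∀ x, f x = g x) : f = g :=
  Subtype.ext (AddMonoidHom.ext h)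

theorem Hom.congr {X Y : RBimod R S} {f g : Hom X Y} (h : f = g) (x : X) : f x = g x := by rw [h]

theorem Hom.comp_apply {X Y Z : RBimod R S} (g : Hom Y Z) (f : Hom X Y) (x : X) :
    (g.comp f) x = g (f x) := rfl

theorem Hom.id_apply {X : RBimod R S} (x : X) : Hom.id X x = x := rfl

theorem Hom.sub_apply {X Y : RBimod R S} (f g : Hom X Y) (x : X) : (f - g) x = f x - g x := rfl

/-- The inverse of a bijective homomorphism. -/
noncomputable def Hom.inv {X Y : RBimod R S} (f : Hom X Y) (hf : Function.Bijective f) :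
    Hom Y X :=
  ⟨(AddEquiv.ofBijective f.1 hf).symm.toAddMonoidHom,
    fun r y => hf.1 (by
      have h := (AddEquiv.ofBijective f.1 hf).apply_symm_apply
      exact (h (r • y)).trans (((f.2.1 r _).trans (congrArg (r • ·) (h y))).symm)),
    fun s y => hf.1 (by
      have h := (AddEquiv.ofBijective f.1 hf).apply_symm_apply
      exact (h (op s • y)).trans (((f.2.2 s _).trans (congrArg (op s • ·) (h y))).symm))⟩

theorem Hom.apply_inv {X Y : RBimod R S} (f : Hom X Y) (hf : Function.Bijective f) (y : Y) :
    f (f.inv hf y) = y :=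
  (AddEquiv.ofBijective f.1 hf).apply_symm_apply y

theorem Hom.inv_apply {X Y : RBimod R S} (f : Hom X Y) (hf : Function.Bijective f) (x : X) :
    f.inv hf (f x) = x :=
  (AddEquiv.ofBijective f.1 hf).symm_apply_apply x

/-- The kernel of a bimodule homomorphism. -/
def ker {X Y : RBimod R S} (f : Hom X Y) : RBimod R S :=
  letI : Module R f.1.ker :=
    { smul := fun r x => ⟨r • x.1, by
        have hx : f x.1 = 0 := x.2
        exact (f.2.1 r x.1).trans (by rw [hx, smul_zero])⟩
      one_smul := fun x => Subtype.ext (one_smul R x.1)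
      mul_smul := fun r r' x => Subtype.ext (mul_smul r r' x.1)
      smul_zero := fun r => Subtype.ext (smul_zero r)
      smul_add := fun r x y => Subtype.ext (smul_add r x.1 y.1)
      add_smul := fun r r' x => Subtype.ext (add_smul r r' x.1)
      zero_smul := fun x => Subtype.ext (zero_smul R x.1) }
  letI : Module Sᵐᵒᵖ f.1.ker :=
    { smul := fun s x => ⟨s • x.1, by
        have hx : f x.1 = 0 := x.2
        exact (f.2.2 s.unop x.1).trans (by rw [hx, smul_zero])⟩
      one_smul := fun x => Subtype.ext (one_smul Sᵐᵒᵖ x.1)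
      mul_smul := fun r r' x => Subtype.ext (mul_smul r r' x.1)
      smul_zero := fun r => Subtype.ext (smul_zero r)
      smul_add := fun r x y => Subtype.ext (smul_add r x.1 y.1)
      add_smul := fun r r' x => Subtype.ext (add_smul r r' x.1)
      zero_smul := fun x => Subtype.ext (zero_smul Sᵐᵒᵖ x.1) }
  { carrier := f.1.ker
    comm := ⟨fun r s x => Subtype.ext (smul_comm r s x.1)⟩ }

/-- The inclusion of the kernel. -/
def kerι {X Y : RBimod R S} (f : Hom X Y) : Hom (ker f) X :=
  ⟨f.1.ker.subtype, fun _ _ => rfl, fun _ _ => rfl⟩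

theorem kerι_injective {X Y : RBimod R S} (f : Hom X Y) : Function.Injective (kerι f) :=
  Subtype.val_injective

/-- A homomorphism that `g` annihilates, as a homomorphism into the kernel of `g`. -/
def kerLift {X Y Z : RBimod R S} (g : Hom Y Z) (f : Hom X Y) (h : ∀ x, g (f x) = 0) :
    Hom X (ker g) :=
  ⟨f.1.codRestrict g.1.ker h, fun r x => Subtype.ext (f.2.1 r x),
    fun s x => Subtype.ext (f.2.2 s x)⟩

/-- Factorization of `φ` through an injective homomorphism whose range contains that of `φ`. -/
theorem Hom.exists_factor {P I Y : RBimod R S} (μ : Hom I Y) (hμ : Function.Injective μ)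
    (φ : Hom P Y) (h : ∀ p, ∃ x, μ x = φ p) : ∃ ψ : Hom P I, μ.comp ψ = φ := by
  choose ψ hψ using h
  exact ⟨⟨AddMonoidHom.mk' ψ fun p q => hμ (by rw [map_add, hψ, hψ, hψ, map_add]),
    fun r p => hμ ((hψ _).trans (((μ.2.1 r _).trans (congrArg (r • ·) (hψ p))).trans
      (φ.2.1 r p).symm).symm),
    fun s p => hμ ((hψ _).trans (((μ.2.2 s _).trans (congrArg (op s • ·) (hψ p))).trans
      (φ.2.2 s p).symm).symm)⟩, Hom.ext hψ⟩

end HomLemmas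

section Cohomology

variable {C C' : ℕ → Type u} [∀ n, AddCommGroup (C n)] [∀ n, AddCommGroup (C' n)]
  {d : ∀ n, C n →+ C (n + 1)} {d' : ∀ n, C' n →+ C' (n + 1)}

theorem map_coboundaries (F : ∀ n, C n →+ C' n) (hF : ∀ n x, d' n (F n x) = F (n + 1) (d n x))
    (n : ℕ) {x : C n} (hx : x ∈ coboundaries C d n) : F n x ∈ coboundaries C' d' n := by
  cases n with
  | zero =>
    have h0 : x = 0 := hx
    rw [h0, map_zero]
    exact zero_mem _
  | succ n =>
    obtain ⟨y, rfl⟩ := hx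
    exact ⟨F n y, hF n y⟩

/-- The map induced on cohomology by a cochain map. -/
noncomputable def cohomologyMap (F : ∀ n, C n →+ C' n)
    (hF : ∀ n x, d' n (F n x) = F (n + 1) (d n x)) (n : ℕ) :
    cohomology C d n →+ cohomology C' d' n :=
  QuotientAddGroup.map _ _
    (((F n).comp (d n).ker.subtype).codRestrict (d' n).ker fun x => by
      have hx : d n x.1 = 0 := x.2
      exact (hF n x.1).trans (by rw [hx, map_zero]))
    fun x hx => map_coboundaries F hF n (x := x.1) hx

/-- Cochain maps that are inverse to each other on cocycles, up to coboundaries, induce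
isomorphisms on cohomology. -/
noncomputable def cohomologyEquiv (F : ∀ n, C n →+ C' n) (G : ∀ n, C' n →+ C n)
    (hF : ∀ n x, d' n (F n x) = F (n + 1) (d n x)) (hG : ∀ n x, d n (G n x) = G (n + 1) (d' n x))
    (hGF : ∀ n x, d n x = 0 → -G n (F n x) + x ∈ coboundaries C d n)
    (hFG : ∀ n x, d' n x = 0 → -F n (G n x) + x ∈ coboundaries C' d' n) (n : ℕ) :
    cohomology C d n ≃+ cohomology C' d' n where
  __ := cohomologyMap F hF n
  invFun := cohomologyMap G hG n
  left_inv z := by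
    obtain ⟨⟨x, hx⟩, rfl⟩ := QuotientAddGroup.mk'_surjective _ z
    exact QuotientAddGroup.eq.2 (hGF n x hx)
  right_inv z := by
    obtain ⟨⟨x, hx⟩, rfl⟩ := QuotientAddGroup.mk'_surjective _ z
    exact QuotientAddGroup.eq.2 (hFG n x hx)

/-- Isomorphic cochain complexes have isomorphic cohomology. -/
theorem nonempty_cohomologyEquiv_of_bijective (F : ∀ n, C n →+ C' n)
    (hF : ∀ n x, d' n (F n x) = F (n + 1) (d n x)) (hb : ∀ n, Function.Bijective (F n)) (n : ℕ) :
    Nonempty (cohomology C d n ≃+ cohomology C' d' n) := by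
  let e := fun n => AddEquiv.ofBijective (F n) (hb n)
  have h1 : ∀ n x, F n ((e n).symm x) = x := fun n => (e n).apply_symm_apply
  have h2 : ∀ n x, (e n).symm (F n x) = x := fun n => (e n).symm_apply_apply
  refine ⟨cohomologyEquiv F (fun n => (e n).symm.toAddMonoidHom) hF (fun n x => ?_)
    (fun n x _ => ?_) (fun n x _ => ?_) n⟩
  · apply (hb (n + 1)).1
    exact (hF n _).symm.trans ((congrArg (d' n) (h1 n x)).trans (h1 _ _).symm)
  · have : -(e n).symm (F n x) + x = 0 := by rw [h2, neg_add_cancel]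
    exact this ▸ zero_mem _
  · have : -F n ((e n).symm x) + x = 0 := by rw [h1, neg_add_cancel]
    exact this ▸ zero_mem _

end Cohomology

/-! ### Comparison of relative projective resolutions -/

section Comparison

variable {A B : Type u} [Ring A] [Ring B] {M : RBimod B A}

/-- Lifting along an admissible map of a homomorphism whose values lie in its range. -/
theorem IsRelProjective.exists_lift {P X Y : RBimod B B} (hP : IsRelProjective M P)
    {f : Hom X Y} (hf : IsAdmissible M f) (φ : Hom P Y) (h : ∀ p, ∃ x, f x = φ p) :
    ∃ ψ : Hom P X, f.comp ψ = φ := by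
  obtain ⟨I, ξ, μ, -, hμ, rfl, hξ⟩ := hf
  obtain ⟨χ, rfl⟩ := Hom.exists_factor μ hμ φ fun p => (h p).imp' ξ fun x hx => hx
  obtain ⟨ψ, rfl⟩ := hP _ _ ξ hξ χ
  exact ⟨ψ, rfl⟩

namespace RelResolution

variable {X : RBimod B B}

/-- The identity of `X` lifts to a chain map between two resolutions of `X`. -/
theorem exists_lift (P P' : RelResolution M X) :
    ∃ f : ∀ n, Hom (P.P n) (P'.P n), (∀ x, P'.ε (f 0 x) = P.ε x) ∧
      ∀ n x, P'.d n (f (n + 1) x) = f n (P.d n x) := by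
  -- The second component of a partial lift is what makes the next step possible.
  let L : ℕ → Type u := fun n =>
    {f : Hom (P.P n) (P'.P n) // ∀ x, ∃ y, P'.d n y = f (P.d n x)}
  have step : ∀ n (f : L n), ∃ g : L (n + 1), ∀ x, P'.d n (g.1 x) = f.1 (P.d n x) := by
    intro n f
    obtain ⟨g, hg⟩ := (P.projective (n + 1)).exists_lift (P'.admissible_d n)
      (f.1.comp (P.d n)) f.2
    have hg' : ∀ x, P'.d n (g x) = f.1 (P.d n x) := Hom.congr hg
    refine ⟨⟨g, fun x => (P'.exact_succ n _).1 ?_⟩, hg'⟩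
    rw [hg', (P.exact_succ n).apply_apply_eq_zero, map_zero]
  obtain ⟨f₀, hf₀⟩ := (P.projective 0).exists_lift P'.admissible_ε P.ε fun _ => P'.surjective _
  have hf₀' : ∀ x, P'.ε (f₀ x) = P.ε x := Hom.congr hf₀
  choose next hnext using step
  let seq : ∀ n, L n := fun n => Nat.rec
    ⟨f₀, fun x => (P'.exact_zero _).1 (by
      rw [hf₀', P.exact_zero.apply_apply_eq_zero])⟩ next n
  exact ⟨fun n => (seq n).1, hf₀', fun n => hnext n (seq n)⟩

/-- A chain map between two resolutions of `X` that lifts the zero map of `X` is null-homotopic. -/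
theorem exists_homotopy (P P' : RelResolution M X) (f : ∀ n, Hom (P.P n) (P'.P n))
    (h0 : ∀ x, P'.ε (f 0 x) = 0) (hf : ∀ n x, P'.d n (f (n + 1) x) = f n (P.d n x)) :
    ∃ s : ∀ n, Hom (P.P n) (P'.P (n + 1)), (∀ x, P'.d 0 (s 0 x) = f 0 x) ∧
      ∀ n x, P'.d (n + 1) (s (n + 1) x) = f (n + 1) x - s n (P.d n x) := by
  -- The second component of a partial homotopy is what makes the next step possible.
  let L : ℕ → Type u := fun n =>
    {s : Hom (P.P n) (P'.P (n + 1)) // ∀ x, P'.d n (s (P.d n x)) = f n (P.d n x)}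
  have step : ∀ n (s : L n), ∃ t : L (n + 1),
      ∀ x, P'.d (n + 1) (t.1 x) = f (n + 1) x - s.1 (P.d n x) := by
    intro n s
    obtain ⟨t, ht⟩ := (P.projective (n + 1)).exists_lift (P'.admissible_d (n + 1))
      (f (n + 1) - s.1.comp (P.d n)) fun x => (P'.exact_succ n _).1 (by
        rw [Hom.sub_apply, map_sub, hf, Hom.comp_apply, s.2, sub_self])
    have ht' : ∀ x, P'.d (n + 1) (t x) = f (n + 1) x - s.1 (P.d n x) := Hom.congr ht
    refine ⟨⟨t, fun x => ?_⟩, ht'⟩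
    rw [ht', (P.exact_succ n).apply_apply_eq_zero, map_zero, sub_zero]
  obtain ⟨s₀, hs₀⟩ := (P.projective 0).exists_lift (P'.admissible_d 0) (f 0) fun x =>
    (P'.exact_zero _).1 (h0 x)
  choose next hnext using step
  let seq : ∀ n, L n := fun n => Nat.rec ⟨s₀, fun x => Hom.congr hs₀ _⟩ next n
  exact ⟨fun n => (seq n).1, Hom.congr hs₀, fun n => hnext n (seq n)⟩

/-- A self-map of a resolution over the identity induces the identity on cohomology. -/
theorem sub_mem_coboundaries (P : RelResolution M X) (f : ∀ n, Hom (P.P n) (P.P n))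
    (h0 : ∀ x, P.ε (f 0 x) = P.ε x) (hf : ∀ n x, P.d n (f (n + 1) x) = f n (P.d n x))
    (N : RBimod B B) (n : ℕ) (c : Hom (P.P n) N) (hc : (P.d n).precomp N c = 0) :
    -(c.comp (f n)) + c ∈
      coboundaries (fun k => Hom (P.P k) N) (fun k => (P.d k).precomp N) n := by
  obtain ⟨s, hs0, hs⟩ := exists_homotopy P P (fun n => Hom.id _ - f n)
    (fun x => by rw [Hom.sub_apply, map_sub, h0, Hom.id_apply, sub_self])
    fun n x => by
      rw [Hom.sub_apply, map_sub, hf, Hom.id_apply, Hom.sub_apply, Hom.id_apply]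
  have hc' : ∀ x, c (P.d n x) = 0 := Hom.congr hc
  have key : ∀ x, (-(c.comp (f n)) + c) x =
      c ((Hom.id _ - f n : Hom (P.P n) (P.P n)) x) := fun x => by
    rw [Hom.sub_apply, map_sub]
    exact neg_add_eq_sub _ _
  cases n with
  | zero =>
    refine (AddSubgroup.mem_bot).2 (Hom.ext fun x => ?_)
    rw [key, ← hs0, hc']
    rfl
  | succ n =>
    refine ⟨c.comp (s n), Hom.ext fun x => ?_⟩
    have h := congrArg c (hs n x)
    rw [hc', map_sub] at h
    exact (sub_eq_zero.1 h.symm).symm.trans (key x).symm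

/-- Relative cohomology does not depend on the resolution. -/
theorem nonempty_extEquiv (P P' : RelResolution M X) (N : RBimod B B) (n : ℕ) :
    Nonempty (P.Ext N n ≃+ P'.Ext N n) := by
  obtain ⟨f, hf0, hf⟩ := exists_lift P' P
  obtain ⟨g, hg0, hg⟩ := exists_lift P P'
  refine ⟨cohomologyEquiv (fun n => (f n).precomp N) (fun n => (g n).precomp N)
    (fun n c => Hom.ext fun x => (congrArg c (hf n x)).symm)
    (fun n c => Hom.ext fun x => (congrArg c (hg n x)).symm)
    (fun n c hc => sub_mem_coboundaries P (fun n => (f n).comp (g n)) (fun x => ?_)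
      (fun n x => ?_) N n c hc)
    (fun n c hc => sub_mem_coboundaries P' (fun n => (g n).comp (f n)) (fun x => ?_)
      (fun n x => ?_) N n c hc) n⟩
  · exact (hf0 _).trans (hg0 x)
  · exact (hf n _).trans (congrArg (f n) (hg n x))
  · exact (hg0 _).trans (hf0 x)
  · exact (hg n _).trans (congrArg (g n) (hf n x))

end RelResolution

end Comparison

/-! ### The resolution given by the comonad `M ⊗_A Hom_B(M, -)` -/

section Adjunction

variable {A B T : Type u} [Ring A] [Ring B] [Ring T] (M : RBimod B A)

/-- The elements of `_B Hom(M, X)` as linear maps. -/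
def homLeftLin {M : RBimod B A} {X : RBimod B T} (g : homLeft M X) : M →ₗ[B] X := g

theorem homLeft_ext {M : RBimod B A} {X : RBimod B T} {g g' : homLeft M X}
    (h : ∀ m, homLeftLin g m = homLeftLin g' m) : g = g' :=
  LinearMap.ext (f := homLeftLin g) (g := homLeftLin g') h

variable {M} in
/-- The homomorphism `M ⊗_A Y → X` corresponding to `Y → _B Hom(M, X)`. -/
def uncurry {Y : RBimod A T} {X : RBimod B T} (k : Hom Y (homLeft M X)) : Hom (tensor M Y) X :=
  tensorLift
    (AddMonoidHom.mk' (fun m => AddMonoidHom.mk' (fun y => homLeftLin (k y) m)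
        fun y y' => congrArg (fun g => homLeftLin g m) (map_add k.1 y y'))
      fun m m' => AddMonoidHom.ext fun y => map_add (homLeftLin (k y)) m m')
    (fun m a y => (congrArg (fun g => homLeftLin g m) (k.2.1 a y)).symm)
    (fun b m y => map_smul (homLeftLin (k y)) b m)
    (fun t m y => congrArg (fun g => homLeftLin g m) (k.2.2 t y))

/-- The unit `Y → _B Hom(M, M ⊗_A Y)`, `y ↦ (m ↦ m ⊗ y)`. -/
def unitHom (Y : RBimod A T) : Hom Y (homLeft M (tensor M Y)) :=
  ⟨AddMonoidHom.mk' (fun y => (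
      { toFun := fun m => tmul m y
        map_add' := fun m m' => add_tmul m m' y
        map_smul' := fun _ _ => rfl } : M →ₗ[B] tensor M Y))
      fun y y' => LinearMap.ext fun m => tmul_add m y y',
    fun a y => LinearMap.ext fun m => (smul_tmul m a y).symm,
    fun _ _ => LinearMap.ext fun _ => rfl⟩

variable {M} in
/-- A bimodule induced from an `A`-`B`-bimodule is projective relative to `M`. -/
theorem isRelProjective_tensor (Y : RBimod A B) : IsRelProjective M (tensor M Y) := by
  rintro X X' f ⟨σ, hσ⟩ g
  refine ⟨uncurry (σ.comp ((homLeftMap M g).comp (unitHom M Y))), Subtype.ext (hom_ext ?_)⟩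
  intro m y
  exact congrArg (fun h => homLeftLin h m) (Hom.congr hσ (homLeftMap M g (unitHom M Y y)))

end Adjunction

section Resolution

variable {A B : Type u} [Ring A] [Ring B] (M : RBimod B A)

/-- The `A`-`B`-bimodules `Y_0 = *M` and `Y_{n+1} = _B Hom(M, M ⊗_A Y_n)`. The terms of the
resolution are the induced bimodules `M ⊗_A Y_n`. -/
def barGen : ℕ → RBimod A B
  | 0 => leftDual M
  | n + 1 => homLeft M (tensor M (barGen n))

/-- The evaluation `M ⊗_A *M → B`. -/
def barε : Hom (tensor M (barGen M 0)) (self B) :=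
  uncurry (M := M) (X := self B) (Hom.id (leftDual M))

/-- The unit `barGen n → _B Hom(M, M ⊗_A barGen n) = barGen (n + 1)`. -/
def barUnit (n : ℕ) : Hom (barGen M n) (barGen M (n + 1)) := unitHom M (barGen M n)

/-- The map `_B Hom(M, d)`, where `d` is the differential of the resolution that ends in degree
`n - 1` (the augmentation if `n = 0`). The expression in the second case is `bard n`, which is
defined below in terms of `barD n`. -/
def barD : ∀ n, Hom (barGen M (n + 1)) (barGen M n)
  | 0 => homLeftMap M (barε M)
  | n + 1 => homLeftMap M
      (uncurry (M := M) (Hom.id (barGen M (n + 1)) - (barUnit M n).comp (barD n)))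

/-- The differential of the resolution. It is defined so that the unit is a contracting homotopy
after applying `_B Hom(M, -)`. -/
def bard (n : ℕ) : Hom (tensor M (barGen M (n + 1))) (tensor M (barGen M n)) :=
  uncurry (M := M) (Hom.id (barGen M (n + 1)) - (barUnit M n).comp (barD M n))

variable {M} in
/-- The elements of `barGen (n + 1)` as linear maps. -/
def barLin {n : ℕ} (z : barGen M (n + 1)) : M →ₗ[B] tensor M (barGen M n) := z

theorem barLin_sub {n : ℕ} (z z' : barGen M (n + 1)) (m : M) :
    barLin (z - z') m = barLin z m - barLin z' m := rfl

theorem bard_tmul (n : ℕ) (m : M) (z : barGen M (n + 1)) :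
    bard M n (tmul m z) = barLin z m - tmul m (barD M n z) := rfl

theorem barLin_barD_succ (n : ℕ) (z : barGen M (n + 2)) (m : M) :
    barLin (barD M (n + 1) z) m = bard M n (barLin z m) := rfl

/-- The homotopy identity `d h + h d = 1` for the unit `h`. -/
theorem barD_barUnit (n : ℕ) (z : barGen M (n + 1)) :
    barD M (n + 1) (barUnit M (n + 1) z) = z - barUnit M n (barD M n z) := rfl

theorem barε_bard (x : tensor M (barGen M 1)) : barε M (bard M 0 x) = 0 := by
  have key : (barε M).comp (bard M 0) = 0 := Subtype.ext (hom_ext fun m z => by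
    change barε M (bard M 0 (tmul m z)) = 0
    rw [bard_tmul, map_sub]
    exact sub_self _)
  exact Hom.congr key x

theorem barD_barD (n : ℕ) (z : barGen M (n + 2)) : barD M n (barD M (n + 1) z) = 0 := by
  induction n with
  | zero => exact homLeft_ext (M := M) fun m => barε_bard M _
  | succ n ih =>
    refine homLeft_ext (M := M) fun m => ?_
    have key : (bard M n).comp (bard M (n + 1)) = 0 := Subtype.ext (hom_ext fun m z => ?_)
    · exact Hom.congr key (barLin z m)
    · change bard M n (bard M (n + 1) (tmul m z)) = 0
      rw [bard_tmul, map_sub, bard_tmul, ih, barLin_barD_succ]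
      refine sub_eq_zero.2 (sub_eq_self.2 ?_).symm
      exact map_zero (tmk M (barGen M n) m)

theorem bard_bard (n : ℕ) (x : tensor M (barGen M (n + 2))) :
    bard M n (bard M (n + 1) x) = 0 := by
  have key : (bard M n).comp (bard M (n + 1)) = 0 := Subtype.ext (hom_ext fun m z =>
    congrArg (fun g => barLin g m) (barD_barD M (n + 1) (barUnit M _ z)))
  exact Hom.congr key x

end Resolution

section Exactness

variable {A B : Type u} [Ring A] [Ring B] {M : RBimod B A}

/-- The trace ideal of a generator is the whole ring. -/
theorem IsLeftProgenerator.exists_sum_eq_one (hM : M.IsLeftProgenerator) :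
    ∃ (ι : Type u) (s : Finset ι) (φ : ι → M →ₗ[B] B) (m : ι → M), ∑ i ∈ s, φ i (m i) = 1 := by
  let I : Submodule B B := Submodule.span B {b | ∃ (φ : M →ₗ[B] B) (m : M), b = φ m}
  have h := hM.generator.def (X := ModuleCat.of B B) (Y := ModuleCat.of B (B ⧸ I))
    (ModuleCat.ofHom I.mkQ) 0 fun g => by
      ext m
      exact (Submodule.Quotient.mk_eq_zero I).2 (Submodule.subset_span ⟨g.hom, m, rfl⟩)
  have h1 : (1 : B) ∈ I := (Submodule.Quotient.mk_eq_zero I).1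
    (congrArg (fun f => f.hom (1 : B)) h)
  have h2 : ∀ b ∈ I, ∃ (ι : Type u) (s : Finset ι) (φ : ι → M →ₗ[B] B) (m : ι → M),
      ∑ i ∈ s, φ i (m i) = b := by
    intro b hb
    induction hb using Submodule.span_induction with
    | mem b hb =>
      obtain ⟨φ, m, rfl⟩ := hb
      exact ⟨PUnit, Finset.univ, fun _ => φ, fun _ => m, by simp⟩
    | zero => exact ⟨PUnit, ∅, 0, 0, by simp⟩
    | add x y _ _ hx hy =>
      obtain ⟨ι, s, φ, m, rfl⟩ := hx
      obtain ⟨κ, t, ψ, k, rfl⟩ := hy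
      exact ⟨ι ⊕ κ, s.disjSum t, Sum.elim φ ψ, Sum.elim m k, by simp [Finset.sum_disjSum]⟩
    | smul b x _ hx =>
      obtain ⟨ι, s, φ, m, rfl⟩ := hx
      exact ⟨ι, s, φ, fun i => b • m i, by simp [Finset.mul_sum]⟩
  exact h2 1 h1

/-- Every element of a left `B`-module is a sum of values of linear maps from a generator `M` that
vanish wherever the element is annihilated. -/
theorem IsLeftProgenerator.exists_sum_eq (hM : M.IsLeftProgenerator) {T : Type u} [Ring T]
    {X Y : RBimod B T} (f : Hom X Y) (x : X) (hx : f x = 0) :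
    ∃ (ι : Type u) (s : Finset ι) (g : ι → homLeft M X) (m : ι → M),
      (∀ i, homLeftMap M f (g i) = 0) ∧ ∑ i ∈ s, homLeftLin (g i) (m i) = x := by
  obtain ⟨ι, s, φ, m, h⟩ := hM.exists_sum_eq_one
  refine ⟨ι, s, fun i => (φ i).smulRight x, m, fun i => homLeft_ext fun k => ?_, ?_⟩
  · change f (φ i k • x) = 0
    rw [f.2.1, hx, smul_zero]
  · change ∑ i ∈ s, φ i (m i) • x = x
    rw [← Finset.sum_smul, h, one_smul]

/-- For a generator `M`, a complex `X → Y → Z` that becomes exact under `_B Hom(M, -)` by means of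
a contracting homomorphism is exact, with admissible first map. -/
theorem IsLeftProgenerator.exact_and_admissible (hM : M.IsLeftProgenerator) {X Y Z : RBimod B B}
    {f : Hom X Y} {g : Hom Y Z} (hgf : ∀ x, g (f x) = 0) (η : Hom (homLeft M Y) (homLeft M X))
    (hη : ∀ z, homLeftMap M g z = 0 → homLeftMap M f (η z) = z) :
    Function.Exact f g ∧ IsAdmissible M f := by
  have hex : ∀ y, g y = 0 → ∃ x, f x = y := by
    intro y hy
    obtain ⟨ι, s, k, m, hk, rfl⟩ := hM.exists_sum_eq g y hy
    refine ⟨∑ i ∈ s, homLeftLin (η (k i)) (m i), (map_sum f.1 _ _).trans ?_⟩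
    exact Finset.sum_congr rfl fun i _ => congrArg (fun h => homLeftLin h (m i)) (hη _ (hk i))
  refine ⟨fun y => ⟨hex y, ?_⟩, ker g, kerLift g f hgf, kerι g, fun y => ?_, kerι_injective g, rfl,
    η.comp (homLeftMap M (kerι g)), Hom.ext fun z => homLeft_ext fun m => ?_⟩
  · rintro ⟨x, rfl⟩
    exact hgf x
  · obtain ⟨x, hx⟩ := hex y.1 y.2
    exact ⟨x, Subtype.ext hx⟩
  · have hz : homLeftMap M g (homLeftMap M (kerι g) z) = 0 :=
      homLeft_ext fun m => (homLeftLin z m).2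
    exact Subtype.ext (congrArg (fun h => homLeftLin h m) (hη _ hz))

theorem IsLeftProgenerator.barε_surjective (hM : M.IsLeftProgenerator) :
    Function.Surjective (barε M) := by
  intro (b : B)
  obtain ⟨ι, s, φ, m, h⟩ := hM.exists_sum_eq_one
  refine ⟨b • ∑ i ∈ s, tmul (Y := barGen M 0) (m i) (φ i), ((barε M).2.1 b _).trans ?_⟩
  have h1 : barε M (∑ i ∈ s, tmul (Y := barGen M 0) (m i) (φ i)) = (1 : B) :=
    (map_sum (barε M).1 _ _).trans h
  exact (congrArg (b • ·) h1).trans (mul_one b)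

theorem IsLeftProgenerator.bard_zero_exact (hM : M.IsLeftProgenerator) :
    Function.Exact (bard M 0) (barε M) ∧ IsAdmissible M (bard M 0) :=
  hM.exact_and_admissible (barε_bard M) (barUnit M 1) fun z hz =>
    (barD_barUnit M 0 z).trans (sub_eq_self.2
      ((congrArg (barUnit M 0) hz).trans (map_zero (barUnit M 0).1)))

theorem IsLeftProgenerator.bard_succ_exact (hM : M.IsLeftProgenerator) (n : ℕ) :
    Function.Exact (bard M (n + 1)) (bard M n) ∧ IsAdmissible M (bard M (n + 1)) :=
  hM.exact_and_admissible (bard_bard M n) (barUnit M (n + 2)) fun z hz =>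
    (barD_barUnit M (n + 1) z).trans (sub_eq_self.2
      ((congrArg (barUnit M (n + 1)) hz).trans (map_zero (barUnit M (n + 1)).1)))

/-- The canonical resolution of `B` relative to a progenerator. -/
def IsLeftProgenerator.resolution (hM : M.IsLeftProgenerator) : RelResolution M (self B) where
  P n := tensor M (barGen M n)
  d := bard M
  ε := barε M
  projective _ := isRelProjective_tensor _
  surjective := hM.barε_surjective
  exact_zero := hM.bard_zero_exact.1
  exact_succ n := (hM.bard_succ_exact n).1
  admissible_ε := ⟨self B, barε M, Hom.id _, hM.barε_surjective, Function.injective_id, rfl,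
    barUnit M 0, rfl⟩
  admissible_d
    | 0 => hM.bard_zero_exact.2
    | n + 1 => (hM.bard_succ_exact n).2

end Exactness

/-! ### Identification of the terms of the resolution with tensor powers -/

section TensorLemmas

variable {R S T U : Type u} [Ring R] [Ring S] [Ring T] [Ring U]

theorem zero_tmul {X : RBimod R S} {Y : RBimod S T} (y : Y) : tmul (0 : X) y = 0 :=
  DFunLike.congr_fun (map_zero (tmk X Y)) y

theorem sub_tmul {X : RBimod R S} {Y : RBimod S T} (x x' : X) (y : Y) :
    tmul (x - x') y = tmul x y - tmul x' y := DFunLike.congr_fun (map_sub (tmk X Y) x x') y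

theorem tmul_zsmul {X : RBimod R S} {Y : RBimod S T} (x : X) (k : ℤ) (y : Y) :
    tmul x (k • y) = k • tmul x y := map_zsmul (tmk X Y x) k y

theorem tmul_sum {X : RBimod R S} {Y : RBimod S T} {ι : Type*} (s : Finset ι) (x : X)
    (y : ι → Y) : tmul x (∑ i ∈ s, y i) = ∑ i ∈ s, tmul x (y i) := map_sum (tmk X Y x) y s

theorem sum_tmul {X : RBimod R S} {Y : RBimod S T} {ι : Type*} (s : Finset ι) (x : ι → X)
    (y : Y) : tmul (∑ i ∈ s, x i) y = ∑ i ∈ s, tmul (x i) y :=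
  map_sum ((tmk X Y).flip y) x s

/-- For fixed `z`, the map `x ⊗ y ↦ x ⊗ (y ⊗ z)`. -/
def assocInvAux (X : RBimod R S) (Y : RBimod S T) (Z : RBimod T U) (z : Z) :
    tensor X Y →+ tensor X (tensor Y Z) :=
  lift (AddMonoidHom.mk' (fun x => AddMonoidHom.mk' (fun y => tmul x (tmul y z)) fun y y' =>
      (congrArg (tmul x) (add_tmul y y' z)).trans (tmul_add _ _ _))
      fun x x' => AddMonoidHom.ext fun y => add_tmul x x' (tmul y z))
    fun x s y => smul_tmul x s (tmul y z)

/-- The associativity isomorphism `(x ⊗ y) ⊗ z ↦ x ⊗ (y ⊗ z)`, as a homomorphism. -/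
def tensorAssocInv (X : RBimod R S) (Y : RBimod S T) (Z : RBimod T U) :
    Hom (tensor (tensor X Y) Z) (tensor X (tensor Y Z)) :=
  tensorLift
    (AddMonoidHom.flip (AddMonoidHom.mk' (assocInvAux X Y Z) fun z z' => hom_ext fun x y =>
      (congrArg (tmul x) (tmul_add y z z')).trans (tmul_add x _ _)))
    (fun w t z => DFunLike.congr_fun
      (f := (assocInvAux X Y Z z).comp (DistribSMul.toAddMonoidHom (tensor X Y) (op t)))
      (g := assocInvAux X Y Z (t • z))
      (hom_ext fun x y => congrArg (tmul x) (smul_tmul y t z)) w)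
    (fun r w z => DFunLike.congr_fun
      (f := (assocInvAux X Y Z z).comp (DistribSMul.toAddMonoidHom (tensor X Y) r))
      (g := (DistribSMul.toAddMonoidHom (tensor X (tensor Y Z)) r).comp (assocInvAux X Y Z z))
      (hom_ext fun _ _ => rfl) w)
    (fun u w z => DFunLike.congr_fun
      (f := assocInvAux X Y Z (op u • z))
      (g := (DistribSMul.toAddMonoidHom (tensor X (tensor Y Z)) (op u)).comp
        (assocInvAux X Y Z z))
      (hom_ext fun _ _ => rfl) w)

/-- The homomorphism `R ⊗_R Y → Y`. -/
def tensorLid (Y : RBimod R S) : Hom (tensor (self R) Y) Y :=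
  tensorLift (X := self R) (Y := Y) (Z := Y)
    (AddMonoidHom.mk' (fun r : R => DistribSMul.toAddMonoidHom Y r) fun r r' : R =>
      AddMonoidHom.ext fun y : Y => add_smul r r' y)
    (fun (r r' : R) (y : Y) => mul_smul r r' y)
    (fun (r r' : R) (y : Y) => mul_smul r r' y)
    (fun (s : S) (r : R) (y : Y) => smul_comm r (op s) y)

theorem tensorLid_bijective (Y : RBimod R S) : Function.Bijective (tensorLid Y) := by
  have h : (tmk (self R) Y (1 : R)).comp (tensorLid Y).1 = AddMonoidHom.id _ :=
    hom_ext fun (r : R) y => (smul_tmul (X := self R) (1 : R) r y).symm.trans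
      (congrArg (fun q : R => tmul (X := self R) q y) (one_mul r))
  exact Function.bijective_iff_has_inverse.2
    ⟨tmk (self R) Y (1 : R), DFunLike.congr_fun h, fun y => one_smul R y⟩

end TensorLemmas

section DualBasis

variable {A B : Type u} [Ring A] [Ring B] {M : RBimod B A}

/-- A finite dual basis of a finitely generated projective module. -/
theorem IsLeftProgenerator.exists_dualBasis (hM : M.IsLeftProgenerator) :
    ∃ (n : ℕ) (e : Fin n → M) (e' : Fin n → M →ₗ[B] B), ∀ x, ∑ i, e' i x • e i = x := by
  have := hM.finite
  have := hM.projective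
  obtain ⟨n, f, hf⟩ := Module.Finite.exists_fin' B M
  obtain ⟨g, hg⟩ := Module.projective_lifting_property f LinearMap.id hf
  refine ⟨n, fun i => f (Pi.single i 1), fun i => (LinearMap.proj i).comp g, fun x => ?_⟩
  have h := LinearMap.congr_fun hg x
  conv_rhs => rw [← LinearMap.id_apply (R := B) x, ← h, LinearMap.comp_apply,
    ← Finset.univ_sum_single (g x), map_sum]
  refine Finset.sum_congr rfl fun i _ => ?_
  rw [← map_smul, ← Pi.single_smul', smul_eq_mul, mul_one]
  rfl

/-- The endomorphism `x ↦ φ(x) m`. -/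
def rankOne (φ : M →ₗ[B] B) (m : M) : EndRing M := op (φ.smulRight m)

theorem rankOne_add (φ : M →ₗ[B] B) (m m' : M) :
    rankOne φ (m + m') = rankOne φ m + rankOne φ m' :=
  congrArg op (LinearMap.ext fun x => smul_add (φ x) m m')

theorem rankOne_smul (φ : M →ₗ[B] B) (m : M) (a : A) :
    rankOne φ (op a • m) = rankOne φ m * M.toEndRing a :=
  congrArg op (LinearMap.ext fun x => smul_comm (φ x) (op a) m)

end DualBasis

section Identification

variable {A B : Type u} [Ring A] [Ring B] (M : RBimod B A)

/-- The ring `S = _B End(M)` as an `A`-bimodule. -/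
abbrev endBimod : RBimod A A := res M.toEndRing (self M.EndRing)

/-- The homomorphism `S ⊗_A Y → _B Hom(M, M ⊗_A Y)`, `s ⊗ y ↦ (m ↦ m s ⊗ y)`. -/
def endTensorHom (Y : RBimod A B) : Hom (tensor (endBimod M) Y) (homLeft M (tensor M Y)) :=
  tensorLift (X := endBimod M) (Y := Y) (Z := homLeft M (tensor M Y))
    (AddMonoidHom.mk' (fun s : M.EndRing => AddMonoidHom.mk' (fun y =>
        ((homLeftLin (unitHom M Y y)).comp s.unop : M →ₗ[B] tensor M Y))
        fun y y' => LinearMap.ext fun m => tmul_add (s.unop m) y y')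
      fun s s' : M.EndRing => AddMonoidHom.ext fun y => LinearMap.ext fun m =>
        add_tmul (s.unop m) (s'.unop m) y)
    (fun (s : M.EndRing) a y => LinearMap.ext fun m => smul_tmul (s.unop m) a y)
    (fun _ _ _ => rfl)
    (fun _ _ _ => rfl)

/-- The homomorphism `S^{⊗ n} ⊗_A *M → Y_n`. In degree `n + 1` it takes `(s ⊗ t) ⊗ φ` to the map
`m ↦ m s ⊗ y`, where `y` is the image of `t ⊗ φ`. -/
def barθ : ∀ n, Hom (tensor (tpow M.toEndRing n) (leftDual M)) (barGen M n)
  | 0 => tensorLid (leftDual M)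
  | n + 1 => ((endTensorHom M (barGen M n)).comp (tensorMap (Hom.id (endBimod M)) (barθ n))).comp
      (tensorAssocInv (endBimod M) (tpow M.toEndRing n) (leftDual M))

/-- The map `s ↦ (t ⊗ φ ↦ (s ⊗ t) ⊗ φ)`. -/
def preAct (n : ℕ) : M.EndRing →+ tensor (tpow M.toEndRing n) (leftDual M) →+
    tensor (tpow M.toEndRing (n + 1)) (leftDual M) :=
  AddMonoidHom.mk' (assocAux (endBimod M) (tpow M.toEndRing n) (leftDual M)) fun s s' =>
    hom_ext fun y z =>
      (congrArg (fun w => tmul (X := tpow M.toEndRing (n + 1)) w z)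
        (add_tmul (X := endBimod M) s s' y)).trans (add_tmul _ _ z)

theorem preAct_mul (n : ℕ) (s : M.EndRing) (a : A)
    (u : tensor (tpow M.toEndRing n) (leftDual M)) :
    preAct M n (s * M.toEndRing a) u = preAct M n s (a • u) :=
  DFunLike.congr_fun (f := preAct M n (s * M.toEndRing a))
    (g := (preAct M n s).comp (DistribSMul.toAddMonoidHom _ a))
    (hom_ext fun y z => congrArg (fun w => tmul (X := tpow M.toEndRing (n + 1)) w z)
      (smul_tmul (X := endBimod M) s a y)) u

variable {M} in
theorem preAct_ext {n : ℕ} {Z : Type u} [AddCommGroup Z]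
    {f g : tensor (tpow M.toEndRing (n + 1)) (leftDual M) →+ Z}
    (h : ∀ s u, f (preAct M n s u) = g (preAct M n s u)) : f = g := by
  refine hom_ext fun x φ => ?_
  exact DFunLike.congr_fun (f := f.comp ((tmk _ (leftDual M)).flip φ))
    (g := g.comp ((tmk _ (leftDual M)).flip φ))
    (tensor_ext (X := endBimod M) (Y := tpow M.toEndRing n) fun s t => h s (tmul t φ)) x

variable {M} in
/-- Evaluation of the elements of `barGen (n + 1)` at an element of `M`. -/
def barEval {n : ℕ} (m : M) : barGen M (n + 1) →+ tensor M (barGen M n) :=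
  AddMonoidHom.mk' (fun z => barLin z m) fun _ _ => rfl

theorem barθ_preAct (n : ℕ) (s : M.EndRing) (u : tensor (tpow M.toEndRing n) (leftDual M))
    (m : M) : barLin (barθ M (n + 1) (preAct M n s u)) m = tmul (s.unop m) (barθ M n u) :=
  DFunLike.congr_fun (f := ((barEval m).comp (barθ M (n + 1)).1).comp (preAct M n s))
    (g := (tmk M (barGen M n) (s.unop m)).comp (barθ M n).1) (hom_ext fun _ _ => rfl) u

variable {M} in
/-- For a dual basis `e_i`, `e'_i` of `M`, the inverse in degree `n + 1` takes `g` to the sum over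
`i` of the elements `(e'_i ⊗ m) ⊗ θ⁻¹ y`, where `m ⊗ y` stands for `g(e_i)`. -/
theorem IsLeftProgenerator.barθ_bijective (hM : M.IsLeftProgenerator) (n : ℕ) :
    Function.Bijective (barθ M n) := by
  induction n with
  | zero => exact tensorLid_bijective _
  | succ n ih =>
    obtain ⟨k, e, e', he⟩ := hM.exists_dualBasis
    let θ' := (barθ M n).inv ih
    -- The map `m ⊗ y ↦ (φ ⊗ m) ⊗ θ⁻¹ y`, where `φ ⊗ m` is a rank one endomorphism.
    let l : (M →ₗ[B] B) → tensor M (barGen M n) →+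
        tensor (tpow M.toEndRing (n + 1)) (leftDual M) := fun φ =>
      lift (AddMonoidHom.mk' (fun m => (preAct M n (rankOne φ m)).comp θ'.1) fun m m' => by
          rw [rankOne_add, map_add]
          rfl)
        fun m a y => (congrArg (fun s => preAct M n s (θ' y)) (rankOne_smul φ m a)).trans <|
          (preAct_mul M n (rankOne φ m) a (θ' y)).trans
            (congrArg (preAct M n (rankOne φ m)) (θ'.2.1 a y).symm)
    have hl : ∀ φ m u, l φ (tmul m (barθ M n u)) = preAct M n (rankOne φ m) u := fun φ m u =>
      congrArg (preAct M n (rankOne φ m)) ((barθ M n).inv_apply ih u)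
    have hθl : ∀ φ w x, barLin (barθ M (n + 1) (l φ w)) x = φ x • w := fun φ w x =>
      DFunLike.congr_fun (f := ((barEval x).comp (barθ M (n + 1)).1).comp (l φ))
        (g := DistribSMul.toAddMonoidHom (tensor M (barGen M n)) (φ x))
        (hom_ext fun m y => (barθ_preAct M n (rankOne φ m) (θ' y) x).trans
          (congrArg (tmul (φ x • m)) ((barθ M n).apply_inv ih y))) w
    let κ : barGen M (n + 1) →+ tensor (tpow M.toEndRing (n + 1)) (leftDual M) :=
      ∑ i, (l (e' i)).comp (barEval (e i))
    have hκ : ∀ g, κ g = ∑ i, l (e' i) (barLin g (e i)) := fun g =>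
      AddMonoidHom.finsetSum_apply _ _ g
    refine Function.bijective_iff_has_inverse.2 ⟨κ, fun u => ?_, fun g => ?_⟩
    · refine DFunLike.congr_fun (f := κ.comp (barθ M (n + 1)).1) (g := AddMonoidHom.id _)
        (preAct_ext fun s u => ?_) u
      refine (hκ _).trans ?_
      have h1 : ∀ i, l (e' i) (barLin (barθ M (n + 1) (preAct M n s u)) (e i)) =
          preAct M n (rankOne (e' i) (s.unop (e i))) u := fun i => by
        rw [barθ_preAct, hl]
      rw [Finset.sum_congr rfl fun i _ => h1 i, ← AddMonoidHom.finsetSum_apply, ← map_sum]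
      refine congrArg (fun s => preAct M n s u) (unop_injective (LinearMap.ext fun x => ?_))
      simp only [rankOne, Finset.unop_sum, unop_op, LinearMap.sum_apply, LinearMap.smulRight_apply]
      conv_rhs => rw [← he x, map_sum]
      simp only [map_smul]
    · refine LinearMap.ext (f := barLin (barθ M (n + 1) (κ g))) (g := barLin g) fun x => ?_
      have h1 : barLin (barθ M (n + 1) (κ g)) x =
          ∑ i, barLin (barθ M (n + 1) (l (e' i) (barLin g (e i)))) x := by
        rw [hκ]
        exact map_sum ((barEval x).comp (barθ M (n + 1)).1) _ _
      rw [h1]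
      simp only [hθl]
      conv_rhs => rw [← he x, map_sum]
      simp only [map_smul]

end Identification

/-! ### The differential in terms of tensor powers -/

section Faces

variable {A S : Type u} [Ring A] [Ring S] (i : A →+* S)

/-- The element `s ⊗ x` of `S^{⊗ n+1}`. -/
def tcons {n : ℕ} (s : S) (x : tpow i n) : tpow i (n + 1) :=
  tmul (X := res i (self S)) (Y := tpow i n) s x

/-- Left multiplication by `s` on the first factor, `s' ⊗ x ↦ s s' ⊗ x`. -/
def headMul {n : ℕ} (s : S) : tpow i (n + 1) →+ tpow i (n + 1) :=
  (mulHead i (tpow i n)).1.comp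
    (tmk (res i (self S)) (tensor (res i (self S)) (tpow i n)) s)

/-- The alternating sum of the maps multiplying two adjacent tensor factors. -/
def altMul (n : ℕ) : tpow i (n + 1) →+ tpow i n :=
  ∑ j : Fin n, (-1 : ℤ) ^ j.val • (mulAt i n j).1

theorem altMul_zero : altMul i 0 = 0 := rfl

/-- The recursion for the inner faces, which matches the recursive definition of `bard`. -/
theorem altMul_tcons (n : ℕ) (s : S) (x : tpow i (n + 1)) :
    altMul i (n + 1) (tcons i s x) = headMul i s x - tcons i s (altMul i n x) := by
  have h : altMul i n x = ∑ j : Fin n, (-1 : ℤ) ^ j.val • mulAt i n j x :=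
    AddMonoidHom.finsetSum_apply _ _ x
  have h' : altMul i (n + 1) (tcons i s x) =
      ∑ j : Fin (n + 1), (-1 : ℤ) ^ j.val • mulAt i (n + 1) j (tcons i s x) :=
    AddMonoidHom.finsetSum_apply _ _ _
  have h3 : tcons i s (∑ j : Fin n, (-1 : ℤ) ^ j.val • mulAt i n j x) =
      ∑ j : Fin n, (-1 : ℤ) ^ j.val • tcons i s (mulAt i n j x) :=
    (tmul_sum (X := res i (self S)) (Y := tpow i n) _ s _).trans
      (Finset.sum_congr rfl fun j _ => tmul_zsmul (X := res i (self S)) s _ _)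
  rw [h, h', h3, Fin.sum_univ_succ, sub_eq_add_neg, ← Finset.sum_neg_distrib]
  refine congrArg₂ (· + ·) ((congrArg (· • _) (pow_zero (-1 : ℤ))).trans (one_smul ℤ _))
    (Finset.sum_congr rfl fun j _ => ?_)
  rw [← neg_smul, Fin.val_succ, pow_succ, mul_neg_one]
  rfl

theorem hochschildD_apply (W : RBimod S S) (n : ℕ) (f : Cochain i W n) (x : tpow i (n + 1)) :
    hochschildD i W n f x =
      leftFace i W n f x - f (altMul i n x) - (-1 : ℤ) ^ n • rightFace i W n f x := by
  have h : altMul i n x = ∑ j : Fin n, (-1 : ℤ) ^ j.val • mulAt i n j x :=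
    AddMonoidHom.finsetSum_apply _ _ x
  have h' : (∑ j : Fin n, (-1 : ℤ) ^ (j.val + 1) • (mulAt i n j).precomp (res i W)) f =
      ∑ j : Fin n, (-1 : ℤ) ^ (j.val + 1) • (mulAt i n j).precomp (res i W) f :=
    AddMonoidHom.finsetSum_apply _ _ f
  have h'' : ((∑ j : Fin n, (-1 : ℤ) ^ (j.val + 1) • (mulAt i n j).precomp (res i W)) f) x =
      -f (altMul i n x) := by
    rw [h', h, map_sum, ← Finset.sum_neg_distrib, AddSubgroup.val_finsetSum,
      AddMonoidHom.finsetSum_apply]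
    refine Finset.sum_congr rfl fun j _ => ?_
    rw [map_zsmul, ← neg_smul, pow_succ, mul_neg_one]
    rfl
  have h3 : hochschildD i W n f x = leftFace i W n f x +
      ((∑ j : Fin n, (-1 : ℤ) ^ (j.val + 1) • (mulAt i n j).precomp (res i W)) f) x +
      (-1 : ℤ) ^ (n + 1) • rightFace i W n f x := rfl
  rw [h3, h'', pow_succ, mul_neg_one, neg_smul, ← sub_eq_add_neg, ← sub_eq_add_neg]

end Faces

section Differential

variable {A B : Type u} [Ring A] [Ring B] (M : RBimod B A)

/-- The left action of the endomorphism ring on `*M`, as a biadditive map. Here `*M` is an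
`A`-`B`-bimodule, so that this action is not part of its structure. -/
def dualAct : M.EndRing →+ leftDual M →+ leftDual M :=
  AddMonoidHom.mk' (fun s => AddMonoidHom.mk'
      (fun φ => ((homLeftLin φ).comp s.unop : M →ₗ[B] self B)) fun _ _ => rfl)
    fun s s' => AddMonoidHom.ext fun φ => LinearMap.ext fun m =>
      map_add (homLeftLin φ) (s.unop m) (s'.unop m)

/-- The map `t ⊗ s ↦ t ⊗ s φ`, for fixed `φ`. -/
def lastAct (n : ℕ) (φ : leftDual M) :
    tensor (tpow M.toEndRing n) (endBimod M) →+ tensor (tpow M.toEndRing n) (leftDual M) :=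
  lift (X := tpow M.toEndRing n) (Y := endBimod M)
    ((tmk (tpow M.toEndRing n) (leftDual M)).compl₂ ((dualAct M).flip φ))
    fun t a (s : M.EndRing) => smul_tmul t a (dualAct M s φ)

theorem lastAct_splitLast_tcons (n : ℕ) (φ : leftDual M) (s : M.EndRing)
    (t : tpow M.toEndRing (n + 1)) :
    lastAct M (n + 1) φ (splitLast M.toEndRing (n + 1) (tcons M.toEndRing s t)) =
      preAct M n s (lastAct M n φ (splitLast M.toEndRing n t)) :=
  DFunLike.congr_fun
    (f := ((lastAct M (n + 1) φ).comp (tensorAssoc (endBimod M) (tpow M.toEndRing n)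
      (endBimod M)).1).comp (tmk (endBimod M) (tensor (tpow M.toEndRing n) (endBimod M)) s))
    (g := (preAct M n s).comp (lastAct M n φ))
    (hom_ext fun _ _ => rfl) (splitLast M.toEndRing n t)

theorem barLin_barθ_tcons (n : ℕ) (φ : leftDual M) (s : M.EndRing) (t : tpow M.toEndRing n)
    (m : M) : barLin (barθ M (n + 1) (tmul (tcons M.toEndRing s t) φ)) m =
      tmul (s.unop m) (barθ M n (tmul t φ)) := rfl

theorem barLin_barθ_headMul (n : ℕ) (φ : leftDual M) (s : M.EndRing)
    (t : tpow M.toEndRing (n + 1)) (m : M) :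
    barLin (barθ M (n + 1) (tmul (headMul M.toEndRing s t) φ)) m =
      barLin (barθ M (n + 1) (tmul t φ)) (s.unop m) :=
  DFunLike.congr_fun
    (f := (((barEval m).comp (barθ M (n + 1)).1).comp
      ((tmk (tpow M.toEndRing (n + 1)) (leftDual M)).flip φ)).comp (headMul M.toEndRing s))
    (g := ((barEval (s.unop m)).comp (barθ M (n + 1)).1).comp
      ((tmk (tpow M.toEndRing (n + 1)) (leftDual M)).flip φ))
    (tensor_ext (X := endBimod M) (Y := tpow M.toEndRing n) fun _ _ => rfl) t

/-- Under the identification with tensor powers, `_B Hom(M, d)` is the part of the Hochschild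
differential that does not involve the leftmost multiplication. -/
theorem barD_barθ (n : ℕ) (x : tpow M.toEndRing (n + 1)) (φ : leftDual M) :
    barD M n (barθ M (n + 1) (tmul x φ)) =
      barθ M n (tmul (altMul M.toEndRing n x) φ) +
        (-1 : ℤ) ^ n • barθ M n (lastAct M n φ (splitLast M.toEndRing n x)) := by
  -- Both sides are additive in `x`, so that it suffices to consider `s ⊗ t`.
  have red : ∀ n x, (∀ (s : M.EndRing) (t : tpow M.toEndRing n),
      barD M n (barθ M (n + 1) (tmul (tcons M.toEndRing s t) φ)) =
        barθ M n (tmul (altMul M.toEndRing n (tcons M.toEndRing s t)) φ) +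
        (-1 : ℤ) ^ n • barθ M n (lastAct M n φ
          (splitLast M.toEndRing n (tcons M.toEndRing s t)))) →
      barD M n (barθ M (n + 1) (tmul x φ)) = barθ M n (tmul (altMul M.toEndRing n x) φ) +
        (-1 : ℤ) ^ n • barθ M n (lastAct M n φ (splitLast M.toEndRing n x)) :=
    fun n x h => DFunLike.congr_fun
      (f := ((barD M n).1.comp (barθ M (n + 1)).1).comp
        ((tmk (tpow M.toEndRing (n + 1)) (leftDual M)).flip φ))
      (g := ((barθ M n).1.comp ((tmk (tpow M.toEndRing n) (leftDual M)).flip φ)).comp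
          (altMul M.toEndRing n) +
        (-1 : ℤ) ^ n • ((barθ M n).1.comp (lastAct M n φ)).comp (splitLast M.toEndRing n).1)
      (tensor_ext (X := endBimod M) (Y := tpow M.toEndRing n) h) x
  induction n with
  | zero =>
    refine red 0 x fun s (a : A) => ?_
    rw [altMul_zero, AddMonoidHom.zero_apply, zero_tmul, map_zero, pow_zero, one_smul]
    refine Eq.trans ?_ (zero_add _).symm
    refine homLeft_ext (M := M) fun m => ?_
    exact congrArg (fun k => homLeftLin φ (op a • s.unop k))
      (one_smul Aᵐᵒᵖ m).symm
  | succ n ih =>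
    refine red (n + 1) x fun s t => LinearMap.ext (f := barLin (n := n) _) (g := barLin (n := n) _)
      fun m => ?_
    have h1 : barLin (barD M (n + 1) (barθ M (n + 2) (tmul (tcons M.toEndRing s t) φ))) m =
        barLin (barθ M (n + 1) (tmul t φ)) (s.unop m) -
          tmul (s.unop m) (barD M n (barθ M (n + 1) (tmul t φ))) := by
      rw [barLin_barD_succ, barLin_barθ_tcons, bard_tmul]
    have h2 : barLin (barθ M (n + 1)
        (tmul (altMul M.toEndRing (n + 1) (tcons M.toEndRing s t)) φ)) m =
        barLin (barθ M (n + 1) (tmul t φ)) (s.unop m) -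
          tmul (s.unop m) (barθ M n (tmul (altMul M.toEndRing n t) φ)) := by
      rw [altMul_tcons, sub_tmul, map_sub, barLin_sub, barLin_barθ_headMul, barLin_barθ_tcons]
    have h3 : barLin (barθ M (n + 1) (lastAct M (n + 1) φ
        (splitLast M.toEndRing (n + 1) (tcons M.toEndRing s t)))) m =
        tmul (s.unop m) (barθ M n (lastAct M n φ (splitLast M.toEndRing n t))) := by
      rw [lastAct_splitLast_tcons, barθ_preAct]
    refine Eq.trans ?_ (map_add (barEval m) _ _).symm
    refine Eq.trans ?_ (congrArg₂ (· + ·) h2.symm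
      ((map_zsmul (barEval m) _ _).trans (congrArg _ h3)).symm)
    rw [h1, ih, tmul_add, tmul_zsmul, ← sub_sub, pow_succ, mul_neg_one, neg_smul, ← sub_eq_add_neg]

end Differential

/-! ### Bimodules of bilinear maps -/

section BiHom

variable {R S : Type u} [Ring R] [Ring S]

/-- The biadditive maps `U × V → X` that are left linear in the first and right linear in the
second variable. -/
def biHoms (U : RBimod R S) (V : RBimod S R) (X : RBimod R R) : AddSubgroup (U →+ V →+ X) where
  carrier := {β | (∀ (r : R) (u : U) (v : V), β (r • u) v = r • β u v) ∧
    ∀ (r : R) (u : U) (v : V), β u (op r • v) = op r • β u v}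
  add_mem' := fun hf hg =>
    ⟨fun r u v => by simp [hf.1, hg.1], fun r u v => by simp [hf.2, hg.2]⟩
  zero_mem' := ⟨fun r u v => by simp, fun r u v => by simp⟩
  neg_mem' := fun hf => ⟨fun r u v => by simp [hf.1], fun r u v => by simp [hf.2]⟩

/-- The `S`-bimodule of the biadditive maps `β : U × V → X` that are left linear in the first and
right linear in the second variable, with `(s β s')(u, v) = β(u s, s' v)`. -/
def biHom (U : RBimod R S) (V : RBimod S R) (X : RBimod R R) : RBimod S S :=
  letI : Module S (biHoms U V X) :=
    { smul := fun s β => ⟨β.1.comp (DistribSMul.toAddMonoidHom U (op s)),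
        fun r u v => (congrArg (fun w => β.1 w v) (smul_comm r (op s) u)).symm.trans
          (β.2.1 r (op s • u) v), fun r u v => β.2.2 r (op s • u) v⟩
      one_smul := fun β => Subtype.ext (AddMonoidHom.ext fun u => congrArg β.1 (one_smul Sᵐᵒᵖ u))
      mul_smul := fun s s' β => Subtype.ext (AddMonoidHom.ext fun u =>
        congrArg β.1 (mul_smul (op s') (op s) u))
      smul_zero := fun _ => rfl
      smul_add := fun _ _ _ => rfl
      add_smul := fun s s' β => Subtype.ext (AddMonoidHom.ext fun u =>
        (congrArg β.1 (add_smul (op s) (op s') u)).trans (map_add β.1 _ _))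
      zero_smul := fun β => Subtype.ext (AddMonoidHom.ext fun u =>
        (congrArg β.1 (zero_smul Sᵐᵒᵖ u)).trans (map_zero β.1)) }
  letI : Module Sᵐᵒᵖ (biHoms U V X) :=
    { smul := fun s β => ⟨β.1.compl₂ (DistribSMul.toAddMonoidHom V s.unop),
        fun r u v => β.2.1 r u (s.unop • v),
        fun r u v => (congrArg (β.1 u) (smul_comm s.unop (op r) v)).trans
          (β.2.2 r u (s.unop • v))⟩
      one_smul := fun β => Subtype.ext (AddMonoidHom.ext fun u => AddMonoidHom.ext fun v =>
        congrArg (β.1 u) (one_smul S v))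
      mul_smul := fun s s' β => Subtype.ext (AddMonoidHom.ext fun u => AddMonoidHom.ext fun v =>
        congrArg (β.1 u) (mul_smul s'.unop s.unop v))
      smul_zero := fun _ => rfl
      smul_add := fun _ _ _ => rfl
      add_smul := fun s s' β => Subtype.ext (AddMonoidHom.ext fun u => AddMonoidHom.ext fun v =>
        (congrArg (β.1 u) (add_smul s.unop s'.unop v)).trans (map_add (β.1 u) _ _))
      zero_smul := fun β => Subtype.ext (AddMonoidHom.ext fun u => AddMonoidHom.ext fun v =>
        (congrArg (β.1 u) (zero_smul S v)).trans (map_zero (β.1 u))) }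
  { carrier := biHoms U V X
    comm := ⟨fun _ _ _ => rfl⟩ }

/-- The element of `biHom U V X` given by a function with the required properties. -/
def mkBiHom {U : RBimod R S} {V : RBimod S R} {X : RBimod R R} (f : U → V → X)
    (h₁ : ∀ u u' v, f (u + u') v = f u v + f u' v) (h₂ : ∀ u v v', f u (v + v') = f u v + f u v')
    (hl : ∀ (r : R) u v, f (r • u) v = r • f u v)
    (hr : ∀ (r : R) u v, f u (op r • v) = op r • f u v) : biHom U V X :=
  (⟨AddMonoidHom.mk' (fun u => AddMonoidHom.mk' (f u) (h₂ u)) fun u u' =>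
    AddMonoidHom.ext (h₁ u u'), hl, hr⟩ : biHoms U V X)

/-- The elements of `biHom U V X` as biadditive maps. -/
def biMap {U : RBimod R S} {V : RBimod S R} {X : RBimod R R} (β : biHom U V X) : U →+ V →+ X :=
  (show biHoms U V X from β).1

/-- Evaluation of the elements of `biHom U V X` at a pair. -/
def biEval {U : RBimod R S} {V : RBimod S R} {X : RBimod R R} (u : U) (v : V) :
    biHom U V X →+ X :=
  AddMonoidHom.mk' (fun β => biMap β u v) fun _ _ => rfl

theorem biHom_ext {U : RBimod R S} {V : RBimod S R} {X : RBimod R R} {β γ : biHom U V X}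
    (h : ∀ u v, biMap β u v = biMap γ u v) : β = γ :=
  Subtype.ext (AddMonoidHom.ext fun u => AddMonoidHom.ext (h u))

theorem biMap_smul_left {U : RBimod R S} {V : RBimod S R} {X : RBimod R R} (β : biHom U V X)
    (r : R) (u : U) (v : V) : biMap β (r • u) v = r • biMap β u v :=
  (show biHoms U V X from β).2.1 r u v

theorem biMap_smul_right {U : RBimod R S} {V : RBimod S R} {X : RBimod R R} (β : biHom U V X)
    (r : R) (u : U) (v : V) : biMap β u (op r • v) = op r • biMap β u v :=
  (show biHoms U V X from β).2.2 r u v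

end BiHom

/-! ### Comparison of the two complexes -/

section Cochains

variable {A B : Type u} [Ring A] [Ring B] (M : RBimod B A)

/-- The `S`-bimodule of bilinear maps `M × *M → N`, which is isomorphic to `coeff M N`. -/
abbrev biCoeff (N : RBimod B B) : RBimod M.EndRing M.EndRing :=
  biHom (overEnd M) (leftDual (overEnd M)) N

/-- The element `m ⊗ t ⊗ φ` of the `n`-th term of the resolution. -/
def barElt {n : ℕ} (t : tpow M.toEndRing n) (m : M) (φ : leftDual M) : tensor M (barGen M n) :=
  tmul m (barθ M n (tmul t φ))

theorem barElt_add₁ {n : ℕ} (t t' : tpow M.toEndRing n) (m : M) (φ : leftDual M) :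
    barElt M (t + t') m φ = barElt M t m φ + barElt M t' m φ := by
  rw [barElt, add_tmul, map_add, tmul_add]; rfl

theorem barElt_add₂ {n : ℕ} (t : tpow M.toEndRing n) (m m' : M) (φ : leftDual M) :
    barElt M t (m + m') φ = barElt M t m φ + barElt M t m' φ := add_tmul _ _ _

theorem barElt_add₃ {n : ℕ} (t : tpow M.toEndRing n) (m : M) (φ φ' : leftDual M) :
    barElt M t m (φ + φ') = barElt M t m φ + barElt M t m φ' := by
  rw [barElt, tmul_add, map_add, tmul_add]; rfl

theorem barElt_right {n : ℕ} (t : tpow M.toEndRing n) (b : B) (m : M) (φ : leftDual M) :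
    barElt M t m (op b • φ) = op b • barElt M t m φ :=
  congrArg (tmul m) ((barθ M n).2.2 b (tmul t φ))

theorem barElt_smul {n : ℕ} (t : tpow M.toEndRing n) (a : A) (m : M) (φ : leftDual M) :
    barElt M (a • t) m φ = barElt M t (op a • m) φ :=
  (congrArg (tmul m) ((barθ M n).2.1 a (tmul t φ))).trans (smul_tmul _ _ _).symm

theorem barElt_op_smul {n : ℕ} (t : tpow M.toEndRing n) (a : A) (m : M) (φ : leftDual M) :
    barElt M (op a • t) m φ = barElt M t m (a • φ) := by
  rw [barElt, smul_tmul]; rfl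

/-- The Hochschild cochain `t ↦ ((m, φ) ↦ f(m ⊗ t ⊗ φ))` of a homomorphism `f` from the `n`-th
term of the resolution to `N`. -/
def barCochain (N : RBimod B B) (n : ℕ) (f : Hom (tensor M (barGen M n)) N) :
    Cochain M.toEndRing (biCoeff M N) n :=
  ⟨AddMonoidHom.mk' (fun t => (⟨AddMonoidHom.mk'
        (fun m : M => AddMonoidHom.mk' (fun φ : leftDual M => f (barElt M t m φ))
          fun φ φ' : leftDual M =>
            (congrArg f (barElt_add₃ M t m φ φ')).trans (map_add f.1 _ _))
        fun m m' : M => AddMonoidHom.ext fun φ : leftDual M => by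
          change f (barElt M t (m + m') φ) = f (barElt M t m φ) + f (barElt M t m' φ)
          rw [barElt_add₂, map_add],
      fun b (m : M) (φ : leftDual M) => f.2.1 b (barElt M t m φ),
      fun b (m : M) (φ : leftDual M) => (congrArg f (barElt_right M t b m φ)).trans
          (f.2.2 b (barElt M t m φ))⟩ : biHoms (overEnd M) (leftDual (overEnd M)) N))
      fun t t' => biHom_ext fun (m : M) (φ : leftDual M) =>
        (congrArg f (barElt_add₁ M t t' m φ)).trans (map_add f.1 _ _),
    fun a t => biHom_ext fun (m : M) (φ : leftDual M) => congrArg f (barElt_smul M t a m φ),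
    fun a t => biHom_ext fun (m : M) (φ : leftDual M) => congrArg f (barElt_op_smul M t a m φ)⟩

/-- `barCochain` as a homomorphism of groups. -/
def barCochainHom (N : RBimod B B) (n : ℕ) :
    Hom (tensor M (barGen M n)) N →+ Cochain M.toEndRing (biCoeff M N) n :=
  AddMonoidHom.mk' (barCochain M N n) fun _ _ => rfl

theorem leftFace_barCochain (N : RBimod B B) (n : ℕ) (f : Hom (tensor M (barGen M n)) N)
    (x : tpow M.toEndRing (n + 1)) (m : M) (φ : leftDual M) :
    biMap (U := overEnd M) (V := leftDual (overEnd M))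
      (leftFace M.toEndRing (biCoeff M N) n (barCochain M N n f) x) m φ =
      f (barLin (barθ M (n + 1) (tmul x φ)) m) :=
  DFunLike.congr_fun
    (f := AddMonoidHom.mk' (fun x => biMap (U := overEnd M) (V := leftDual (overEnd M))
      (leftFace M.toEndRing (biCoeff M N) n (barCochain M N n f) x) m φ) fun x y =>
        congrArg (fun β => biMap (U := overEnd M) (V := leftDual (overEnd M)) β m φ)
          (map_add (leftFace M.toEndRing (biCoeff M N) n (barCochain M N n f)).1 x y))
    (g := f.1.comp (((barEval m).comp (barθ M (n + 1)).1).comp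
      ((tmk (tpow M.toEndRing (n + 1)) (leftDual M)).flip φ)))
    (tensor_ext (X := endBimod M) (Y := tpow M.toEndRing n) fun _ _ => rfl) x

theorem rightFace_barCochain (N : RBimod B B) (n : ℕ) (f : Hom (tensor M (barGen M n)) N)
    (x : tpow M.toEndRing (n + 1)) (m : M) (φ : leftDual M) :
    biMap (U := overEnd M) (V := leftDual (overEnd M))
      (rightFace M.toEndRing (biCoeff M N) n (barCochain M N n f) x) m φ =
      f (tmul m (barθ M n (lastAct M n φ (splitLast M.toEndRing n x)))) := by
  let h : Hom (tensor (tpow M.toEndRing n) (endBimod M)) (res M.toEndRing (biCoeff M N)) :=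
    (rightMul M.toEndRing (biCoeff M N)).comp
      (tensorMap (barCochain M N n f) (Hom.id (endBimod M)))
  exact DFunLike.congr_fun
    (f := AddMonoidHom.mk' (fun w => biMap (U := overEnd M) (V := leftDual (overEnd M))
      (h w) m φ) fun x y =>
        congrArg (fun β => biMap (U := overEnd M) (V := leftDual (overEnd M)) β m φ)
          (map_add h.1 x y))
    (g := f.1.comp ((tmk M (barGen M n) m).comp ((barθ M n).1.comp (lastAct M n φ))))
    (hom_ext fun _ _ => rfl) (splitLast M.toEndRing n x)

/-- The passage to Hochschild cochains commutes with the differentials. -/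
theorem hochschildD_barCochain (N : RBimod B B) (n : ℕ) (f : Hom (tensor M (barGen M n)) N) :
    hochschildD M.toEndRing (biCoeff M N) n (barCochainHom M N n f) =
      barCochainHom M N (n + 1) ((bard M n).precomp N f) := by
  refine Hom.ext fun x => ?_
  refine (hochschildD_apply M.toEndRing (biCoeff M N) n (barCochain M N n f) x).trans ?_
  refine biHom_ext fun (m : M) (φ : leftDual M) => ?_
  have h1 : f (bard M n (tmul m (barθ M (n + 1) (tmul x φ)))) =
      f (barLin (barθ M (n + 1) (tmul x φ)) m) -
        f (tmul m (barθ M n (tmul (altMul M.toEndRing n x) φ))) -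
        (-1 : ℤ) ^ n • f (tmul m (barθ M n (lastAct M n φ (splitLast M.toEndRing n x)))) := by
    rw [bard_tmul, barD_barθ, map_sub, tmul_add, tmul_zsmul, map_add, map_zsmul, sub_sub]
  refine Eq.trans ?_ h1.symm
  rw [← leftFace_barCochain, ← rightFace_barCochain]
  rfl

/-- The `n`-th term of the resolution is generated by the elements `m ⊗ t ⊗ φ`. -/
theorem barElt_ext (hM : M.IsLeftProgenerator) {n : ℕ} {N : RBimod B B}
    {f g : Hom (tensor M (barGen M n)) N}
    (h : ∀ t m φ, f (barElt M t m φ) = g (barElt M t m φ)) : f = g := by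
  refine Subtype.ext (hom_ext fun m y => ?_)
  obtain ⟨u, rfl⟩ := (hM.barθ_bijective n).2 y
  exact DFunLike.congr_fun (f := f.1.comp ((tmk M (barGen M n) m).comp (barθ M n).1))
    (g := g.1.comp ((tmk M (barGen M n) m).comp (barθ M n).1))
    (hom_ext fun t φ => h t m φ) u

theorem barCochainHom_bijective (hM : M.IsLeftProgenerator) (N : RBimod B B) (n : ℕ) :
    Function.Bijective (barCochainHom M N n) := by
  constructor
  · intro f g hfg
    refine barElt_ext M hM fun t m φ => ?_
    exact congrArg (fun β => biMap (U := overEnd M) (V := leftDual (overEnd M)) β m φ)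
      (Hom.congr hfg t)
  · intro c
    let c' : tpow M.toEndRing n → M →+ leftDual M →+ N := fun t =>
      biMap (U := overEnd M) (V := leftDual (overEnd M)) (c t)
    let k : Hom (tensor (tpow M.toEndRing n) (leftDual M)) (homLeft M N) :=
      tensorLift (AddMonoidHom.mk' (fun t => AddMonoidHom.mk' (fun φ =>
            ({ toFun := fun m => c' t m φ
               map_add' := fun m m' => DFunLike.congr_fun (map_add (c' t) m m') φ
               map_smul' := fun b m => biMap_smul_left (U := overEnd M)
                 (V := leftDual (overEnd M)) (c t) b m φ } : M →ₗ[B] N))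
            fun φ φ' => LinearMap.ext fun m => map_add (c' t m) φ φ')
          fun t t' => AddMonoidHom.ext fun φ => LinearMap.ext fun m =>
            congrArg (fun β => biMap (U := overEnd M) (V := leftDual (overEnd M)) β m φ)
              (map_add c.1 t t'))
        (fun t a φ => LinearMap.ext fun m =>
          congrArg (fun β => biMap (U := overEnd M) (V := leftDual (overEnd M)) β m φ)
            (c.2.2 a t))
        (fun a t φ => LinearMap.ext fun m =>
          congrArg (fun β => biMap (U := overEnd M) (V := leftDual (overEnd M)) β m φ)
            (c.2.1 a t))
        (fun b t φ => LinearMap.ext fun m => biMap_smul_right (U := overEnd M)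
          (V := leftDual (overEnd M)) (c t) b m φ)
    refine ⟨uncurry (k.comp ((barθ M n).inv (hM.barθ_bijective n))), Hom.ext fun t =>
      biHom_ext fun (m : M) (φ : leftDual M) => ?_⟩
    exact congrArg (fun u => homLeftLin (k u) m)
      ((barθ M n).inv_apply (hM.barθ_bijective n) (tmul t φ))

end Cochains

/-! ### Coefficient bimodules -/

section DualTensor

variable {B S : Type u} [Ring B] [Ring S] (U : RBimod B S)

variable {U} in
/-- The elements of `*U` as linear forms. -/
def dualLin (φ : leftDual U) : U →ₗ[B] B := φ

/-- The homomorphism `*U ⊗_B N → _B Hom(U, N)`, `φ ⊗ x ↦ (u ↦ φ(u) x)`. -/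
def dualTensorHom (N : RBimod B B) : Hom (tensor (leftDual U) N) (homLeft U N) :=
  tensorLift
    (AddMonoidHom.mk' (fun φ => AddMonoidHom.mk' (fun x =>
        ((dualLin φ).smulRight x : U →ₗ[B] N)) fun x x' => LinearMap.ext fun u =>
          smul_add (dualLin φ u) x x')
      fun φ φ' => AddMonoidHom.ext fun x => LinearMap.ext fun u =>
        add_smul (dualLin φ u) (dualLin φ' u) x)
    (fun φ b x => LinearMap.ext fun u => mul_smul (dualLin φ u) b x)
    (fun _ _ _ => rfl)
    (fun b φ x => LinearMap.ext fun u => smul_comm (dualLin φ u) (op b) x)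

/-- The homomorphism `_B Hom(U, N) ⊗_B U → biHom U *U N`, `g ⊗ u ↦ ((u', φ) ↦ g(u') φ(u))`. -/
def homLeftTensorHom (N : RBimod B B) :
    Hom (tensor (homLeft U N) U) (biHom U (leftDual U) N) :=
  tensorLift
    (AddMonoidHom.mk' (fun g => AddMonoidHom.mk' (fun u => (⟨AddMonoidHom.mk' (fun u' =>
          AddMonoidHom.mk' (fun φ => op (dualLin φ u) • homLeftLin g u')
            fun φ φ' => add_smul (op (dualLin φ u)) (op (dualLin φ' u)) (homLeftLin g u'))
          fun v v' => AddMonoidHom.ext fun φ =>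
            (congrArg (op (dualLin φ u) • ·) (map_add (homLeftLin g) v v')).trans
              (smul_add _ _ _),
        fun b u' φ => (congrArg (op (dualLin φ u) • ·) (map_smul (homLeftLin g) b u')).trans
          (smul_comm b (op (dualLin φ u)) (homLeftLin g u')).symm,
        fun b u' φ => mul_smul (op b) (op (dualLin φ u)) (homLeftLin g u')⟩ :
          biHoms U (leftDual U) N))
        fun v v' => biHom_ext fun u' φ =>
          (congrArg (fun b : B => op b • homLeftLin g u') (map_add (dualLin φ) v v')).trans
            (add_smul (op (dualLin φ v)) (op (dualLin φ v')) (homLeftLin g u')))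
      fun g g' => AddMonoidHom.ext fun u => biHom_ext fun u' φ =>
        smul_add (op (dualLin φ u)) (homLeftLin g u') (homLeftLin g' u'))
    (fun g b u => biHom_ext fun u' φ =>
      ((congrArg (fun c : B => op c • homLeftLin g u') (map_smul (dualLin φ) b u)).trans
        (mul_smul (op (dualLin φ u)) (op b) (homLeftLin g u'))).symm)
    (fun _ _ _ => rfl)
    (fun _ _ _ => rfl)

/-- The homomorphism `*U ⊗_B N ⊗_B U → biHom U *U N`, `φ ⊗ x ⊗ u ↦ ((u', φ') ↦ φ(u') x φ'(u))`. -/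
def dualTensorBiHom (N : RBimod B B) :
    Hom (tensor (tensor (leftDual U) N) U) (biHom U (leftDual U) N) :=
  (homLeftTensorHom U N).comp (tensorMap (dualTensorHom U N) (Hom.id U))

variable {U} {k : ℕ} {e : Fin k → U} {e' : Fin k → leftDual U}

/-- The dual of a dual basis expands the elements of `*U`. -/
theorem sum_op_smul_dual (he : ∀ x, ∑ i, dualLin (e' i) x • e i = x) (φ : leftDual U) :
    ∑ i, op (dualLin φ (e i)) • e' i = φ := by
  have h : ∀ u, homLeftLin (∑ i, op (dualLin φ (e i)) • e' i) u =
      ∑ i, dualLin (e' i) u * dualLin φ (e i) := fun u => LinearMap.sum_apply _ _ u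
  refine homLeft_ext fun u => (h u).trans ?_
  refine Eq.trans ?_ (congrArg (dualLin φ) (he u))
  rw [map_sum]
  exact Finset.sum_congr rfl fun i _ => (map_smul (dualLin φ) _ _).symm

/-- If `U` has a finite dual basis `e_i`, `e'_i`, the inverse takes `β` to the sum of the elements
`e'_i ⊗ β(e_i, e'_j) ⊗ e_j`. -/
theorem dualTensorBiHom_bijective (he : ∀ x, ∑ i, dualLin (e' i) x • e i = x)
    (N : RBimod B B) : Function.Bijective (dualTensorBiHom U N) := by
  let κ : biHom U (leftDual U) N →+ tensor (tensor (leftDual U) N) U :=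
    AddMonoidHom.mk' (fun β => ∑ j, tmul (∑ i, tmul (e' i) (biMap β (e i) (e' j))) (e j))
      fun β γ => by
        rw [← Finset.sum_add_distrib]
        refine Finset.sum_congr rfl fun j _ => ?_
        rw [← add_tmul, ← Finset.sum_add_distrib]
        refine congrArg (fun z => tmul z (e j)) (Finset.sum_congr rfl fun i _ => ?_)
        exact tmul_add (e' i) (biMap β (e i) (e' j)) (biMap γ (e i) (e' j))
  refine Function.bijective_iff_has_inverse.2 ⟨κ, fun z => ?_, fun β => ?_⟩
  · refine DFunLike.congr_fun (f := κ.comp (dualTensorBiHom U N).1) (g := AddMonoidHom.id _)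
      (hom_ext fun y u => ?_) z
    refine DFunLike.congr_fun (f := (κ.comp (dualTensorBiHom U N).1).comp
      ((tmk (tensor (leftDual U) N) U).flip u)) (g := (tmk (tensor (leftDual U) N) U).flip u)
      (hom_ext fun φ x => ?_) y
    change ∑ j, tmul (∑ i, tmul (e' i) (op (dualLin (e' j) u) • dualLin φ (e i) • x)) (e j) =
      tmul (tmul φ x) u
    have h1 : ∀ j, ∑ i, tmul (e' i) (op (dualLin (e' j) u) • dualLin φ (e i) • x) =
        op (dualLin (e' j) u) • tmul φ x := fun j => by
      rw [right_tmul]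
      conv_rhs => rw [← sum_op_smul_dual he φ, sum_tmul]
      refine Finset.sum_congr rfl fun i _ => ?_
      rw [smul_tmul, ← smul_comm (dualLin φ (e i)) (op (dualLin (e' j) u)) x]
    simp only [h1, smul_tmul]
    rw [← tmul_sum, he]
  · refine biHom_ext fun u φ => ?_
    have h1 : ∀ w, biMap (dualTensorBiHom U N (κ w)) u φ =
        ∑ j, ∑ i, op (dualLin φ (e j)) • dualLin (e' i) u • biMap w (e i) (e' j) := fun w => by
      let F : tensor (tensor (leftDual U) N) U →+ N :=
        AddMonoidHom.mk' (fun z => biMap (dualTensorBiHom U N z) u φ) fun z z' =>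
          congrArg (fun β => biMap β u φ) (map_add (dualTensorBiHom U N).1 z z')
      refine (map_sum F (fun j => tmul (∑ i, tmul (e' i) (biMap w (e i) (e' j))) (e j))
        Finset.univ).trans
        (Finset.sum_congr rfl fun j _ => ?_)
      rw [sum_tmul]
      exact map_sum F (fun i => tmul (tmul (e' i) (biMap w (e i) (e' j))) (e j)) _
    rw [h1]
    conv_rhs => rw [← he u, ← sum_op_smul_dual he φ, map_sum, map_sum]
    refine Finset.sum_congr rfl fun j _ => ?_
    rw [AddMonoidHom.finsetSum_apply]
    refine Finset.sum_congr rfl fun i _ => ?_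
    rw [biMap_smul_left, biMap_smul_right]
    exact (smul_comm (dualLin (e' i) u) (op (dualLin φ (e j))) _).symm

end DualTensor

section EndCoefficients

variable {A B : Type u} [Ring A] [Ring B] {M : RBimod B A}

/-- The rank one endomorphism `x ↦ φ(x) m`, as a biadditive map. -/
def rankOneHom (M : RBimod B A) : leftDual (overEnd M) →+ overEnd M →+ M.EndRing :=
  AddMonoidHom.mk' (fun φ => AddMonoidHom.mk' (fun m => rankOne (M := M) φ m)
      fun m m' => rankOne_add (M := M) φ m m')
    fun φ φ' => AddMonoidHom.ext fun m => congrArg op (LinearMap.ext fun x =>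
      add_smul (dualLin φ x) (dualLin φ' x) m)

theorem rankOneHom_smul_left (s : M.EndRing) (φ : leftDual (overEnd M)) (m : overEnd M) :
    rankOneHom M (s • φ) m = s * rankOneHom M φ m := rfl

theorem rankOneHom_smul_right (s : M.EndRing) (φ : leftDual (overEnd M)) (m : overEnd M) :
    rankOneHom M φ (op s • m) = rankOneHom M φ m * s :=
  congrArg op (LinearMap.ext fun x => (map_smul s.unop (dualLin φ x) m).symm)

theorem rankOneHom_balanced (b : B) (φ : leftDual (overEnd M)) (m : overEnd M) :
    rankOneHom M (op b • φ) m = rankOneHom M φ (b • m) :=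
  congrArg op (LinearMap.ext fun x => mul_smul (dualLin φ x) b m)

theorem rankOneHom_smul_dual (φ φ' : leftDual (overEnd M)) (m : overEnd M) :
    rankOneHom M φ m • φ' = op (dualLin φ' m) • φ :=
  homLeft_ext fun x => map_smul (dualLin φ') (dualLin φ x) m

theorem op_rankOneHom_smul (φ : leftDual (overEnd M)) (m m' : overEnd M) :
    op (rankOneHom M φ m) • m' = dualLin φ m' • m := rfl

theorem sum_rankOneHom {k : ℕ} {e : Fin k → overEnd M} {e' : Fin k → leftDual (overEnd M)}
    (he : ∀ x, ∑ i, dualLin (e' i) x • e i = x) : ∑ i, rankOneHom M (e' i) (e i) = 1 :=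
  unop_injective (LinearMap.ext fun x => by
    rw [Finset.unop_sum, LinearMap.sum_apply]
    exact he x)

/-- For an `S`-bimodule `W`, the map `W → biHom M *M (biHom *M M W)`,
`w ↦ (m, φ) ↦ (φ', m') ↦ (φ' ⊗ m) w (φ ⊗ m')`. -/
def toBiHomBiHom (W : RBimod M.EndRing M.EndRing) :
    Hom W (biCoeff M (biHom (leftDual (overEnd M)) (overEnd M) W)) :=
  ⟨AddMonoidHom.mk' (fun w => mkBiHom (fun m φ => mkBiHom
        (fun φ' m' => rankOneHom M φ' m • op (rankOneHom M φ m') • w)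
        (fun φ' φ'' m' => by rw [map_add, AddMonoidHom.add_apply, add_smul])
        (fun φ' m' m'' => by rw [map_add, op_add, add_smul, smul_add])
        (fun s φ' m' => by rw [rankOneHom_smul_left, mul_smul])
        (fun s φ' m' => by rw [rankOneHom_smul_right, op_mul, mul_smul, smul_comm]))
      (fun m m' φ => biHom_ext fun φ' k => by
        change rankOneHom M φ' (m + m') • op (rankOneHom M φ k) • w =
          rankOneHom M φ' m • op (rankOneHom M φ k) • w +
            rankOneHom M φ' m' • op (rankOneHom M φ k) • w
        rw [map_add, add_smul])
      (fun m φ ψ => biHom_ext fun φ' k => by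
        change rankOneHom M φ' m • op (rankOneHom M (φ + ψ) k) • w =
          rankOneHom M φ' m • op (rankOneHom M φ k) • w +
            rankOneHom M φ' m • op (rankOneHom M ψ k) • w
        rw [map_add, AddMonoidHom.add_apply, op_add, add_smul, smul_add])
      (fun b m φ => biHom_ext fun φ' k => by
        change rankOneHom M φ' (b • m) • op (rankOneHom M φ k) • w =
          rankOneHom M (op b • φ') m • op (rankOneHom M φ k) • w
        rw [rankOneHom_balanced])
      (fun b m φ => biHom_ext fun φ' k => by
        change rankOneHom M φ' m • op (rankOneHom M (op b • φ) k) • w =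
          rankOneHom M φ' m • op (rankOneHom M φ (b • k)) • w
        rw [rankOneHom_balanced]))
      fun w w' => biHom_ext fun m φ => biHom_ext fun φ' m' => by
        change rankOneHom M φ' m • op (rankOneHom M φ m') • (w + w') =
          rankOneHom M φ' m • op (rankOneHom M φ m') • w +
            rankOneHom M φ' m • op (rankOneHom M φ m') • w'
        rw [smul_add, smul_add],
    fun s w => biHom_ext fun m φ => biHom_ext fun φ' m' => by
      change rankOneHom M φ' m • op (rankOneHom M φ m') • s • w =
        rankOneHom M φ' (op s • m) • op (rankOneHom M φ m') • w
      rw [rankOneHom_smul_right, mul_smul, ← smul_comm s],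
    fun s w => biHom_ext fun m φ => biHom_ext fun φ' m' => by
      change rankOneHom M φ' m • op (rankOneHom M φ m') • op s • w =
        rankOneHom M φ' m • op (rankOneHom M (s • φ) m') • w
      rw [rankOneHom_smul_left, op_mul, mul_smul]⟩

theorem biMap_toBiHomBiHom (W : RBimod M.EndRing M.EndRing) (w : W) (m m' : overEnd M)
    (φ φ' : leftDual (overEnd M)) : biMap (biMap (toBiHomBiHom W w) m φ) φ' m' =
      rankOneHom M φ' m • op (rankOneHom M φ m') • w := rfl

/-- Every `S`-bimodule `W` arises from the `B`-bimodule of bilinear maps `*M × M → W`. With a dual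
basis `e_i`, `e'_i` of `M`, the inverse takes `γ` to the sum of the `γ(e_i, e'_j)(e'_i, e_j)`. -/
theorem toBiHomBiHom_bijective {k : ℕ} {e : Fin k → overEnd M} {e' : Fin k → leftDual (overEnd M)}
    (he : ∀ x, ∑ i, dualLin (e' i) x • e i = x) (W : RBimod M.EndRing M.EndRing) :
    Function.Bijective (toBiHomBiHom W) := by
  refine Function.bijective_iff_has_inverse.2
    ⟨fun γ => ∑ i, ∑ j, biMap (biMap γ (e i) (e' j)) (e' i) (e j), fun w => ?_, fun γ => ?_⟩
  · simp only [biMap_toBiHomBiHom]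
    simp only [← Finset.smul_sum, ← Finset.sum_smul, ← Finset.op_sum, sum_rankOneHom he,
      op_one, one_smul]
  · refine biHom_ext fun m φ => biHom_ext fun φ' m' => ?_
    rw [biMap_toBiHomBiHom]
    simp only [Finset.smul_sum]
    have h1 : ∀ i j, rankOneHom M φ' m • op (rankOneHom M φ m') •
        biMap (biMap γ (e i) (e' j)) (e' i) (e j) =
        biMap (biMap γ (dualLin (e' i) m • e i) (op (dualLin φ (e j)) • e' j)) φ' m' := by
      intro i j
      rw [← biMap_smul_right, ← biMap_smul_left, rankOneHom_smul_dual, op_rankOneHom_smul,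
        biMap_smul_left, biMap_smul_right]
      rfl
    simp only [h1]
    have h2 : ∀ ψ, biMap (biMap γ m ψ) φ' m' =
        ∑ i, biMap (biMap γ (dualLin (e' i) m • e i) ψ) φ' m' := fun ψ =>
      (congrArg (fun x => biMap (biMap γ x ψ) φ' m') (he m).symm).trans
        (map_sum ((biEval φ' m').comp ((biMap γ).flip ψ)) _ _)
    have h3 : ∀ x, biMap (biMap γ x φ) φ' m' =
        ∑ j, biMap (biMap γ x (op (dualLin φ (e j)) • e' j)) φ' m' := fun x =>
      (congrArg (fun ψ => biMap (biMap γ x ψ) φ' m') (sum_op_smul_dual he φ).symm).trans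
        (map_sum ((biEval φ' m').comp (biMap γ x)) _ _)
    exact ((h2 φ).trans (Finset.sum_congr rfl fun i _ => h3 _)).symm

end EndCoefficients

/-! ### The comparison isomorphism -/

section Invariance

variable {A S : Type u} [Ring A] [Ring S] (i : A →+* S)

/-- Isomorphic coefficient bimodules have isomorphic relative Hochschild cohomology. -/
theorem nonempty_relHochschild_equiv {W W' : RBimod S S} (g : Hom W W')
    (hg : Function.Bijective g) (n : ℕ) :
    Nonempty (relHochschild i W n ≃+ relHochschild i W' n) := by
  let g' : Hom (res i W) (res i W') := ⟨g.1, fun a => g.2.1 (i a), fun a => g.2.2 (i a)⟩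
  refine nonempty_cohomologyEquiv_of_bijective
    (fun n => (AddMonoidHom.mk' (fun f => g'.comp f) fun f f' => Hom.ext fun x =>
      map_add g.1 (f x) (f' x) : Cochain i W n →+ Cochain i W' n))
    (fun n f => Hom.ext fun x => ?_)
    (fun n => ⟨fun f f' h => Hom.ext fun x => hg.1 (Hom.congr h x), fun f =>
      ⟨(g'.inv hg).comp f, Hom.ext fun x => g'.apply_inv hg _⟩⟩) n
  have hl : leftFace i W' n (g'.comp f) x = g (leftFace i W n f x) :=
    DFunLike.congr_fun (f := (leftFace i W' n (g'.comp f)).1)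
      (g := g.1.comp (leftFace i W n f).1)
      (tensor_ext (X := res i (self S)) (Y := tpow i n) fun (s : S) t => (g.2.1 s (f t)).symm) x
  have hr : rightFace i W' n (g'.comp f) x = g (rightFace i W n f x) :=
    DFunLike.congr_fun
      (f := ((rightMul i W').comp (tensorMap (g'.comp f) (Hom.id (res i (self S))))).1)
      (g := g.1.comp ((rightMul i W).comp (tensorMap f (Hom.id (res i (self S))))).1)
      (hom_ext fun t (s : S) => (g.2.2 s (f t)).symm) (splitLast i n x)
  refine (hochschildD_apply i W' n (g'.comp f) x).trans ?_
  refine Eq.trans ?_ (congrArg g (hochschildD_apply i W n f x)).symm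
  rw [hl, hr]
  refine Eq.trans ?_ (map_sub g.1 _ _).symm
  refine congrArg₂ (· - ·) (map_sub g.1 _ _).symm (map_zsmul g.1 _ _).symm

end Invariance

section Conclusion

variable {A B : Type u} [Ring A] [Ring B] {M : RBimod B A}

/-- Relative cohomology of `B` is the relative Hochschild cohomology of the endomorphism ring. -/
theorem IsLeftProgenerator.nonempty_extEquiv (hM : M.IsLeftProgenerator)
    (P : RelResolution M (self B)) (N : RBimod B B) (n : ℕ) :
    Nonempty (P.Ext N n ≃+ relHochschild M.toEndRing (M.coeff N) n) := by
  obtain ⟨k, e, e', he⟩ := hM.exists_dualBasis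
  obtain ⟨f₁⟩ := P.nonempty_extEquiv hM.resolution N n
  obtain ⟨f₂⟩ : Nonempty (hM.resolution.Ext N n ≃+ relHochschild M.toEndRing (biCoeff M N) n) :=
    nonempty_cohomologyEquiv_of_bijective (barCochainHom M N)
      (hochschildD_barCochain M N) (barCochainHom_bijective M hM N) n
  obtain ⟨f₃⟩ := nonempty_relHochschild_equiv M.toEndRing (dualTensorBiHom (overEnd M) N)
    (dualTensorBiHom_bijective (U := overEnd M) (e := e) (e' := e') he N) n
  exact ⟨(f₁.trans f₂).trans f₃.symm⟩

/-- Vanishing for all coefficients is equivalent on both sides, since up to isomorphism every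
`S`-bimodule is of the form `coeff M N`. -/
theorem IsLeftProgenerator.vanishes_iff (hM : M.IsLeftProgenerator)
    (P : RelResolution M (self B)) (n : ℕ) :
    P.Vanishes n ↔ HochschildVanishes M.toEndRing n := by
  refine ⟨fun h W => ?_, fun h N => ?_⟩
  · obtain ⟨k, e, e', he⟩ := hM.exists_dualBasis
    let N : RBimod B B := biHom (leftDual (overEnd M)) (overEnd M) W
    obtain ⟨f₁⟩ := hM.nonempty_extEquiv P N n
    obtain ⟨f₂⟩ := nonempty_relHochschild_equiv M.toEndRing (dualTensorBiHom (overEnd M) N)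
      (dualTensorBiHom_bijective (U := overEnd M) (e := e) (e' := e') he N) n
    obtain ⟨f₃⟩ := nonempty_relHochschild_equiv M.toEndRing (toBiHomBiHom W)
      (toBiHomBiHom_bijective (e := e) (e' := e') he W) n
    have := h N
    exact ((f₁.trans f₂).trans f₃.symm).symm.toEquiv.subsingleton
  · obtain ⟨f⟩ := hM.nonempty_extEquiv P N n
    have := h (M.coeff N)
    exact f.toEquiv.subsingleton

end Conclusion

end RBimod

theorem mainTheorem4 {A B : Type u} [Ring A] [Ring B] (M : RBimod B A)
    (hM : M.IsLeftProgenerator) :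
    Nonempty (RBimod.RelResolution M (RBimod.self B)) ∧
    ∀ P : RBimod.RelResolution M (RBimod.self B),
      (∀ (N : RBimod B B) (n : ℕ),
        Nonempty (P.Ext N n ≃+ RBimod.relHochschild M.toEndRing (M.coeff N) n)) ∧
      (∀ n : ℕ,
        (∀ N : RBimod B B, Subsingleton (P.Ext N n)) ↔
        (∀ W : RBimod M.EndRing M.EndRing,
          Subsingleton (RBimod.relHochschild M.toEndRing W n))) ∧
      P.hdim = RBimod.relHdim M.toEndRing :=
  ⟨⟨hM.resolution⟩, fun P => ⟨hM.nonempty_extEquiv P, hM.vanishes_iff P,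
    congrArg RBimod.dimOf (funext fun n => propext (hM.vanishes_iff P n))⟩⟩
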